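/- Let $G$ be a finite directed graph with edge set $E$; for $e\in E$ let $s(e)$ and $r(e)$ be its initial and final vertex. The graph inverse semigroup of $G$ is the semigroup with zero generated by idempotents $P_v$ ($v$ a vertex) and elements $e^-,e^+$ ($e\in E$), subject to $P_uP_w=0$ for $u\ne w$, $P_{s(e)}e^-=e^-=e^-P_{r(e)}$, $P_{r(e)}e^+=e^+=e^+P_{s(e)}$, $e^-e^+=P_{s(e)}$, and $e^-f^+=0$ for $e\neq f$. The Markov–Dyck shift $D_G$ is the subshift of all bi-infinite sequences over the alphabet $\{e^-,e^+ : e\in E\}$ all of whose finite subwords have a non-zero product in this semigroup. For a subshift $X$ let $\Pi_n(X)$ be the number of points of $X$ fixed by the $n$-th power of the shift, let $\mathcal L_n(X)$ be the set of words of length $n$ that appear in points of $X$, and put $\zeta_X(z)=\exp\big(\sum_{n\ge1}\Pi_n(X)z^n/n\big)$ and $h(X)=\lim_{n\to\infty}\frac1n\log\operatorname{card}\mathcal L_n(X)$. Let $D_F$ be the Fibonacci–Dyck shift, that is, the Markov–Dyck shift of the directed graph with adjacency matrix $F=\begin{bmatrix}1&1\\1&0\end{bmatrix}$. 1. There is a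 continuous function $\xi$ on the closed disc $|z|\le \frac{2}{3\sqrt3}$, analytic in the open disc, with $\xi(0)=0$ and $\xi(z)^3-\xi(z)+z=0$. On every disc $|z|<\rho$ with $0<\rho\le\frac{2}{3\sqrt3}$ it is the only continuous solution of this equation that vanishes at $0$. Moreover $$\xi(x)=\frac{2}{\sqrt3}\,\sin\Big(\frac13\arcsin\Big(\frac{3\sqrt3}{2}\,x\Big)\Big),\qquad 0\le x\le\frac{2}{3\sqrt3}.$$ 2. For every complex $z$ with $|z|<\frac38$ the series $\sum_{n\ge1}\Pi_n(D_F)z^n/n$ converges absolutely and $2\xi(z)^2+\xi(z)-1\ne0$; if moreover $z\neq0$, then $$\zeta_{D_F}(z)=\frac{\xi(z)}{z\,\big(2\xi(z)^2+\xi(z)-1\big)^2}.$$ 3. The equation $2\xi(x)^2+\xi(x)-1=0$ has exactly one solution $z_0$ in the interval $0\le x\le\frac{2}{3\sqrt3}$; it satisfies $0<z_0<\frac{2}{3\sqrt3}$. The limit defining the topological entropy of $D_F$ exists, and $$h(D_F)=-\log z_0=3\log2-\log3 .$$ -/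

import Mathlib

open Set Filter Topology
open SymbolicDynamics.FullShift

namespace MarkovDyck

/-! ### Subshifts: words, periodic points, entropy, zeta function -/

section Subshifts

/-- The word of length `n` that appears in the bi-infinite sequence `x` at position `i`. -/
def wordAt {A : Type*} (x : ℤ → A) (i : ℤ) (n : ℕ) : Fin n → A :=
  fun k => x (i + ((k : ℕ) : ℤ))

/-- The admissible words of length `n` of a subshift `X`: those that appear in a point of `X`. -/
def admissibleWords {A : Type*} [TopologicalSpace A] (X : Subshift A ℤ) (n : ℕ) :
    Set (Fin n → A) :=
  {w | ∃ x ∈ X.carrier, ∃ i : ℤ, wordAt x i n = w}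

/-- `h` is the topological entropy of `X`: the limit of `(1 / n) log card L_n(X)` exists
and is equal to `h`. -/
def IsTopologicalEntropy {A : Type*} [TopologicalSpace A] (X : Subshift A ℤ) (h : ℝ) : Prop :=
  Tendsto (fun n : ℕ => 1 / (n : ℝ) * Real.log ((admissibleWords X n).ncard : ℝ)) atTop (𝓝 h)

/-- The number of points of period `n` of `X`, that is, of the points of `X` that are fixed by
the `n`-th power of the left shift. -/
noncomputable def periodicCount {A : Type*} [TopologicalSpace A] (X : Subshift A ℤ) (n : ℕ) : ℕ :=
  {x ∈ X.carrier | Function.IsPeriodicPt (shift (1 : ℤ)) n x}.ncard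

/-- The `n`-th term `Π_n(X) z ^ n / n` of the series in the exponent of the zeta function. -/
noncomputable def zetaTerm {A : Type*} [TopologicalSpace A] (X : Subshift A ℤ) (z : ℂ) (n : ℕ) :
    ℂ :=
  (periodicCount X n : ℂ) * z ^ n / (n : ℂ)

/-- The zeta function `exp (∑_{n ≥ 1} Π_n(X) z ^ n / n)` of `X`. -/
noncomputable def zeta {A : Type*} [TopologicalSpace A] (X : Subshift A ℤ) (z : ℂ) : ℂ :=
  Complex.exp (∑' n : ℕ, zetaTerm X z (n + 1))

end Subshifts

/-! ### Directed graphs and graph inverse semigroups -/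

section Graphs

/-- A directed graph (loops and multiple edges allowed) with vertex set `V` and edge set `E`. -/
structure DirectedGraph (V E : Type*) where
  /-- the initial vertex of an edge -/
  s : E → V
  /-- the final vertex of an edge -/
  r : E → V

/-- The directed graph with adjacency matrix `M`: it has `M u v` edges from `u` to `v`. -/
def graphOfMatrix {V : Type*} (M : Matrix V V ℕ) :
    DirectedGraph V (Σ u : V, Σ v : V, Fin (M u v)) where
  s e := e.1
  r e := e.2.1

/-- The alphabet of the Markov-Dyck shift: two disjoint copies `E⁻` and `E⁺` of the edge set. -/
inductive Letter (E : Type*)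
  | minus (e : E) : Letter E
  | plus (e : E) : Letter E

/-- The alphabet is discrete. -/
instance instTopologicalSpaceLetter {E : Type*} : TopologicalSpace (Letter E) := ⊥

instance instDiscreteTopologyLetter {E : Type*} : DiscreteTopology (Letter E) := ⟨rfl⟩

/-- Generators of the graph inverse semigroup: the letters and an idempotent for each vertex. -/
inductive Gen (V E : Type*)
  | letter (a : Letter E) : Gen V E
  | vertex (v : V) : Gen V E

/-- The free monoid on the generators with a zero adjoined. -/
abbrev FreeWithZero (V E : Type*) : Type _ := WithZero (FreeMonoid (Gen V E))

/-- The idempotent `P v`, as a word. -/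
def P {V : Type*} (E : Type*) (v : V) : FreeWithZero V E :=
  ((FreeMonoid.of (Gen.vertex v) : FreeMonoid (Gen V E)) : FreeWithZero V E)

/-- The generator `e⁻`, as a word. -/
def em (V : Type*) {E : Type*} (e : E) : FreeWithZero V E :=
  ((FreeMonoid.of (Gen.letter (Letter.minus e)) : FreeMonoid (Gen V E)) : FreeWithZero V E)

/-- The generator `e⁺`, as a word. -/
def ep (V : Type*) {E : Type*} (e : E) : FreeWithZero V E :=
  ((FreeMonoid.of (Gen.letter (Letter.plus e)) : FreeMonoid (Gen V E)) : FreeWithZero V E)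

/-- The defining relations of the graph inverse semigroup of `G`, where `e⁻` leads from `s e` to
`r e` and `e⁺` leads back from `r e` to `s e`. -/
inductive InverseRel {V E : Type*} (G : DirectedGraph V E) :
    FreeWithZero V E → FreeWithZero V E → Prop
  | vertex_mul_self (v : V) : InverseRel G (P E v * P E v) (P E v)
  | vertex_mul_vertex (u w : V) (h : u ≠ w) : InverseRel G (P E u * P E w) 0
  | source_mul_minus (f : E) : InverseRel G (P E (G.s f) * em V f) (em V f)
  | minus_mul_range (f : E) : InverseRel G (em V f * P E (G.r f)) (em V f)
  | range_mul_plus (f : E) : InverseRel G (P E (G.r f) * ep V f) (ep V f)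
  | plus_mul_source (f : E) : InverseRel G (ep V f * P E (G.s f)) (ep V f)
  | minus_mul_plus (f : E) : InverseRel G (em V f * ep V f) (P E (G.s f))
  | minus_mul_plus_of_ne (f g : E) (h : f ≠ g) : InverseRel G (em V f * ep V g) 0
  | plus_mul_minus_of_ne (f g : E) (h : G.s f ≠ G.s g) : InverseRel G (ep V g * em V f) 0
  | minus_mul_minus_of_ne (f g : E) (h : G.r f ≠ G.s g) : InverseRel G (em V f * em V g) 0
  | plus_mul_plus_of_ne (f g : E) (h : G.r f ≠ G.s g) : InverseRel G (ep V g * ep V f) 0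

/-- The graph inverse semigroup of `G`, given by generators and relations (as a semigroup with
zero; an identity, the class of the empty word, is adjoined to it). -/
abbrev GraphInverseSemigroup {V E : Type*} (G : DirectedGraph V E) : Type _ :=
  (conGen (InverseRel G)).Quotient

/-- The zero of the graph inverse semigroup. -/
def zeroElt {V E : Type*} (G : DirectedGraph V E) : GraphInverseSemigroup G :=
  (conGen (InverseRel G)).toQuotient 0

/-- The element of the graph inverse semigroup that is given by a letter. -/
def letterElt {V E : Type*} (G : DirectedGraph V E) : Letter E → GraphInverseSemigroup G
  | Letter.minus e => (conGen (InverseRel G)).toQuotient (em V e)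
  | Letter.plus e => (conGen (InverseRel G)).toQuotient (ep V e)

/-- The product of the letters of a word in the graph inverse semigroup. -/
def wordProd {V E : Type*} (G : DirectedGraph V E) {n : ℕ} (w : Fin n → Letter E) :
    GraphInverseSemigroup G :=
  (List.ofFn fun k => letterElt G (w k)).prod

end Graphs

/-! ### Markov-Dyck shifts -/

section Shifts

/-- The Markov-Dyck shift of `G`: the bi-infinite sequences in the letters `e⁻`, `e⁺` all of
whose finite subwords have a non-zero product. -/
def markovDyckShift {V E : Type*} (G : DirectedGraph V E) : Subshift (Letter E) ℤ where
  carrier := {x | ∀ (i : ℤ) (n : ℕ), wordProd G (wordAt x i n) ≠ zeroElt G}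
  isClosed := by
    have h : {x : ℤ → Letter E | ∀ (i : ℤ) (n : ℕ), wordProd G (wordAt x i n) ≠ zeroElt G} =
        ⋂ (i : ℤ) (n : ℕ), (fun x : ℤ → Letter E => wordAt x i n) ⁻¹'
          {w | wordProd G w ≠ zeroElt G} := by
      ext x
      simp
    rw [h]
    refine isClosed_iInter fun i => isClosed_iInter fun n => ?_
    refine (isClosed_discrete _).preimage ?_
    unfold wordAt
    fun_prop
  mapsTo := by
    intro g x hx i n
    have h : wordAt (shift g x) i n = wordAt x (g + i) n := by
      funext k
      simp [wordAt, add_assoc]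
    rw [h]
    exact hx (g + i) n

/-- The Fibonacci-Dyck shift: the Markov-Dyck shift of the directed graph with adjacency matrix
`F = [[1, 1], [1, 0]]`. -/
def fibonacciDyckShift :
    Subshift (Letter (Σ u : Fin 2, Σ v : Fin 2,
      Fin ((!![1, 1; 1, 0] : Matrix (Fin 2) (Fin 2) ℕ) u v))) ℤ :=
  markovDyckShift (graphOfMatrix !![1, 1; 1, 0])

end Shifts

end MarkovDyck

/-! A word is read by a stack machine: `e⁻` pushes `e` and `e⁺` pops it. These operations represent
the graph inverse semigroup. A word has a non-zero product exactly when it can be read from some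
empty stack, provided that unmatched pops on the empty stack are allowed (`prod_ne_zeroElt_iff`).
This is the lax machine (`b = true`); the strict one forbids unmatched pops, and its loops at an
empty stack are the Dyck words.

The loops at a state form a free monoid on the first-return words. If these have generating function
`c`, the loops have generating function `1/(1 - c)` (`hasSum_returns`). If the code is circular, the
periodic sequences that have a loop as a window have zeta function `1/(1 - c)` as well: each loop
window gets weight one over its number of visits, and `∑ c^k/k = -log (1 - c)`
(`ncard_cyclicPoints`, `hasSum_cyclicPoints`).

Periodic points are sorted by their net push over a period. Time reversal exchanges the signs, so
the points of period `n`, plus those of net push `0`, are twice those of net push `≤ 0`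
(`periodicCount_add`). Points of net push `≤ 0` are those with a lax loop at an empty stack as a
window. For the Fibonacci graph this yields `2A + B₁ - B₀`, where `A` counts lax loops at vertex `0`
and `B_v` strict loops at `v`, all in the cyclic sense (`periodicCount_fib`).

Let `T` be the Dyck series at vertex `1`. The one at `0` is `T²`, and `T = 1 + z²T³`, so `ξ = zT`
solves the cubic (`dyckSeries_relations`). The strict codes contribute `T/T²` and the lax code `(1 -
c)⁻²` with `T(1 - c) = 1 - ξ - 2ξ²`, whence the zeta function. Since `1 - ξ - 2ξ² = (1 - 2ξ)(1 +
ξ)`, the critical point is `ξ = 1/2`, that is `z = 3/8`. Two continuous roots of the cubic can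
separate only at a double root, which forces `|z| = 2/(3√3)`.

Convergence and entropy come from comparison functions on the set of stacks. A superharmonic
function at the radius `2/(3√3)`, where `T = 3/2`, bounds the Dyck series. A bounded positive
eigenfunction for `8/3`, built from `T(3/8) = 4/3`, bounds the number of words from below, and
superharmonic functions for every `r < 3/8` bound it from above. -/

namespace MarkovDyck

/-! ### First-return codes of partial automata -/

section Automaton

variable {A S : Type*} (step : A → S → Option S)

/-- The state reached by a partial automaton when it reads a word. -/
def run : List A → S → Option S
  | [], s => some s
  | a :: w, s => (step a s).bind (run w)

theorem run_append (u v : List A) (s : S) :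
    run step (u ++ v) s = (run step u s).bind (run step v) := by
  induction u generalizing s with
  | nil => rfl
  | cons a u ih =>
    simp only [List.cons_append, run]
    cases step a s with
    | none => rfl
    | some t => simpa using ih t

/-- The words that lead from the state `s` back to `s`. -/
def returns (s : S) : Set (List A) := {w | run step w s = some s}

variable {step} in
theorem append_mem_returns {s : S} {u v : List A} (hu : u ∈ returns step s) :
    u ++ v ∈ returns step s ↔ v ∈ returns step s := by
  have hu' : run step u s = some s := hu
  simp [returns, run_append, hu']

theorem nil_mem_returns (s : S) : [] ∈ returns step s := rfl

/-- The non-empty words that lead from `s` to `s` and do not visit `s` in between. -/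
def firstReturns (s : S) : Set (List A) :=
  {w | w ∈ returns step s ∧ w ≠ [] ∧ ∀ u v, w = u ++ v → u ∈ returns step s → u = [] ∨ v = []}

open Classical in
/-- The number of visits to `s` before the last letter of a word is read. -/
noncomputable def visits (s : S) (w : List A) : ℕ :=
  ((Finset.range w.length).filter fun i => w.take i ∈ returns step s).card

/-- The concatenations of `k` first-return words. -/
def returnPowers (s : S) : ℕ → Set (List A)
  | 0 => {[]}
  | k + 1 => {w | ∃ u ∈ firstReturns step s, ∃ v ∈ returnPowers s k, w = u ++ v}

theorem mem_returns_of_mem_returnPowers {s : S} {k : ℕ} {w : List A}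
    (hw : w ∈ returnPowers step s k) : w ∈ returns step s := by
  induction k generalizing w with
  | zero => obtain rfl : w = [] := hw; rfl
  | succ k ih =>
    obtain ⟨u, hu, v, hv, rfl⟩ := hw
    exact (append_mem_returns hu.1).2 (ih hv)

/-- No visit occurs strictly inside `u`, and the visits from the end of `u` on are those of `v`; the
start of `u` is the extra one. The end of a word is not counted, so the empty word has no visit. -/
theorem visits_append_of_mem_firstReturns {s : S} {u v : List A}
    (hu : u ∈ firstReturns step s) : visits step s (u ++ v) = visits step s v + 1 := by
  classical
  have hpos : 0 < u.length := List.length_pos_iff.2 hu.2.1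
  have hsplit : (Finset.range (u ++ v).length).filter (fun i => (u ++ v).take i ∈ returns step s)
      = insert 0 (((Finset.range v.length).filter fun i => v.take i ∈ returns step s).map
        (addLeftEmbedding u.length)) := by
    ext i
    simp only [Finset.mem_filter, Finset.mem_range, List.length_append, Finset.mem_insert,
      Finset.mem_map, addLeftEmbedding_apply]
    constructor
    · rintro ⟨hi, hmem⟩
      rcases lt_or_ge i u.length with h | h
      · left
        rw [List.take_append_of_le_length h.le] at hmem
        rcases hu.2.2 (u.take i) (u.drop i) (List.take_append_drop i u).symm hmem with h' | h'
        · rcases List.take_eq_nil_iff.1 h' with h0 | h0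
          · exact h0
          · exact absurd h0 hu.2.1
        · exact absurd (List.drop_eq_nil_iff.1 h') (not_le.2 h)
      · right
        obtain ⟨j, rfl⟩ := Nat.exists_eq_add_of_le h
        refine ⟨j, ⟨by omega, ?_⟩, rfl⟩
        rw [List.take_length_add_append] at hmem
        exact (append_mem_returns hu.1).1 hmem
    · rintro (rfl | ⟨j, ⟨hj, hmem⟩, rfl⟩)
      · exact ⟨by omega, by simp [nil_mem_returns]⟩
      · refine ⟨by omega, ?_⟩
        rw [List.take_length_add_append]
        exact (append_mem_returns hu.1).2 hmem
  unfold visits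
  rw [hsplit, Finset.card_insert_of_notMem, Finset.card_map]
  simp only [Finset.mem_map, addLeftEmbedding_apply, not_exists, not_and]
  omega

theorem visits_of_mem_returnPowers {s : S} {k : ℕ} {w : List A}
    (hw : w ∈ returnPowers step s k) : visits step s w = k := by
  induction k generalizing w with
  | zero => obtain rfl : w = [] := hw; simp [visits]
  | succ k ih =>
    obtain ⟨u, hu, v, hv, rfl⟩ := hw
    rw [visits_append_of_mem_firstReturns step hu, ih hv]

theorem exists_firstReturn_append {s : S} {w : List A} (hw : w ∈ returns step s) (h0 : w ≠ []) :
    ∃ u ∈ firstReturns step s, ∃ v ∈ returns step s, w = u ++ v := by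
  classical
  have hex : ∃ i, 0 < i ∧ w.take i ∈ returns step s :=
    ⟨w.length, List.length_pos_iff.2 h0, by simpa using hw⟩
  have hlt : ∀ j, 0 < j → j < Nat.find hex → w.take j ∉ returns step s :=
    fun j hj hjlt hmem => Nat.find_min hex hjlt ⟨hj, hmem⟩
  obtain ⟨hi, hmem⟩ := Nat.find_spec hex
  have hile : Nat.find hex ≤ w.length :=
    Nat.find_min' hex ⟨List.length_pos_iff.2 h0, by simpa using hw⟩
  generalize Nat.find hex = i at *
  refine ⟨w.take i, ⟨hmem, ?_, ?_⟩, w.drop i, ?_, (List.take_append_drop i w).symm⟩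
  · simp [List.take_eq_nil_iff, h0, hi.ne']
  · intro u v huv hu
    by_contra! hne
    have hul : u.length + v.length = i := by
      rw [← List.length_append, ← huv, List.length_take, min_eq_left hile]
    have hup := List.length_pos_iff.2 hne.1
    have hvp := List.length_pos_iff.2 hne.2
    refine hlt u.length hup (by omega) ?_
    have : w.take u.length = u := by
      have h1 : (w.take i).take u.length = u := by rw [huv]; simp
      rwa [List.take_take, min_eq_left (by omega)] at h1
    rwa [this]
  · rw [← append_mem_returns hmem, List.take_append_drop]
    exact hw

theorem exists_mem_returnPowers {s : S} {w : List A} (hw : w ∈ returns step s) :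
    ∃ k, w ∈ returnPowers step s k := by
  induction hn : w.length using Nat.strong_induction_on generalizing w with
  | _ n ih =>
    rcases eq_or_ne w [] with rfl | h0
    · exact ⟨0, rfl⟩
    · obtain ⟨u, hu, v, hv, rfl⟩ := exists_firstReturn_append step hw h0
      have hup := List.length_pos_iff.2 hu.2.1
      rw [List.length_append] at hn
      obtain ⟨k, hk⟩ := ih v.length (by omega) hv rfl
      exact ⟨k + 1, u, hu, v, hk, rfl⟩

/-- One of `u`, `u'` is a prefix of the other, and a first return has no proper non-empty prefix
that returns: the code is a prefix code, hence generates freely. -/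
theorem append_injective_of_firstReturns {s : S} {u u' v v' : List A}
    (hu : u ∈ firstReturns step s) (hu' : u' ∈ firstReturns step s) (h : u ++ v = u' ++ v') :
    u = u' ∧ v = v' := by
  rcases List.append_eq_append_iff.1 h with ⟨t, rfl, rfl⟩ | ⟨t, rfl, rfl⟩
  · rcases hu'.2.2 u t rfl hu.1 with h1 | rfl
    · exact absurd h1 hu.2.1
    · simp
  · rcases hu.2.2 u' t rfl hu'.1 with h1 | rfl
    · exact absurd h1 hu'.2.1
    · simp

theorem exists_equiv_sigma_returnPowers (s : S) :
    ∃ ψ : (Σ k, returnPowers step s k) ≃ returns step s, ∀ p, (ψ p : List A) = p.2 := by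
  refine ⟨Equiv.ofBijective
    (fun p => ⟨p.2, mem_returns_of_mem_returnPowers step p.2.2⟩) ⟨?_, ?_⟩, fun _ => rfl⟩
  · rintro ⟨k, w, hw⟩ ⟨l, w', hw'⟩ h
    obtain rfl : w = w' := Subtype.ext_iff.1 h
    obtain rfl : k = l := by
      rw [← visits_of_mem_returnPowers step hw, visits_of_mem_returnPowers step hw']
    rfl
  · rintro ⟨w, hw⟩
    obtain ⟨k, hk⟩ := exists_mem_returnPowers step hw
    exact ⟨⟨k, w, hk⟩, rfl⟩

variable {F : Type*} [NormedField F] [CompleteSpace F]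

/-- Unique factorization turns concatenation into a product of series. The absolute convergence is
carried through the induction because the product of sums needs it. -/
theorem hasSum_returnPowers {s : S} {z c : F}
    (hc : HasSum (fun u : firstReturns step s => z ^ (u : List A).length) c)
    (hn : Summable fun u : firstReturns step s => ‖z‖ ^ (u : List A).length) (k : ℕ) :
    HasSum (fun w : returnPowers step s k => z ^ (w : List A).length) (c ^ k) ∧
      Summable fun w : returnPowers step s k => ‖z‖ ^ (w : List A).length := by
  induction k with
  | zero =>
    have : Unique (returnPowers step s 0) := Set.uniqueSingleton []
    refine ⟨?_, (hasSum_unique _).summable⟩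
    convert hasSum_unique (fun w : returnPowers step s 0 => z ^ (w : List A).length) using 1
    have : ((default : returnPowers step s 0) : List A) = [] := Subtype.prop (default : returnPowers step s 0)
    simp [this]
  | succ k ih =>
    let φ : firstReturns step s × returnPowers step s k → returnPowers step s (k + 1) :=
      fun p => ⟨p.1 ++ p.2, p.1, p.1.2, p.2, p.2.2, rfl⟩
    have hφ : Function.Bijective φ := by
      constructor
      · rintro ⟨u, v⟩ ⟨u', v'⟩ h
        have := append_injective_of_firstReturns step u.2 u'.2 (Subtype.ext_iff.1 h)
        exact Prod.ext (Subtype.ext this.1) (Subtype.ext this.2)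
      · rintro ⟨w, u, hu, v, hv, rfl⟩
        exact ⟨(⟨u, hu⟩, ⟨v, hv⟩), rfl⟩
    have hsum : Summable fun p : firstReturns step s × returnPowers step s k =>
        ‖z‖ ^ (p.1 : List A).length * ‖z‖ ^ (p.2 : List A).length :=
      hn.mul_of_nonneg ih.2 (fun _ => by positivity) (fun _ => by positivity)
    have hlen : ∀ p, ((φ p : returnPowers step s (k + 1)) : List A).length =
        (p.1 : List A).length + (p.2 : List A).length := fun p => List.length_append
    clear_value φ
    constructor
    · rw [← (Equiv.ofBijective φ hφ).hasSum_iff, pow_succ']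
      have hmul := hc.mul ih.1 (Summable.of_norm (by simpa only [norm_mul, norm_pow] using hsum))
      refine hmul.congr_fun fun p => ?_
      rw [Function.comp_apply, Equiv.ofBijective_apply, hlen, pow_add]
    · rw [← (Equiv.ofBijective φ hφ).summable_iff]
      refine hsum.congr fun p => ?_
      rw [Function.comp_apply, Equiv.ofBijective_apply, hlen, pow_add]

/-- Sums over all words that lead back to `s`, weighted by a function of the number of visits. -/
theorem hasSum_returns {s : S} {z c : F} {r C : ℝ} (hz : ‖z‖ = r)
    (hc : HasSum (fun u : firstReturns step s => z ^ (u : List A).length) c)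
    (hn : HasSum (fun u : firstReturns step s => r ^ (u : List A).length) C)
    {φ : ℕ → F} {σ : F} (hφ : HasSum (fun k => φ k * c ^ k) σ)
    (hφn : Summable fun k => ‖φ k‖ * C ^ k) :
    HasSum (fun w : returns step s => φ (visits step s w) * z ^ (w : List A).length) σ := by
  obtain ⟨ψ, hψ⟩ := exists_equiv_sigma_returnPowers step s
  have hr : 0 ≤ r := hz ▸ norm_nonneg z
  have hrn : ‖r‖ = r := Real.norm_of_nonneg hr
  have hreal : ∀ k, HasSum (fun w : returnPowers step s k => r ^ (w : List A).length) (C ^ k) :=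
    fun k => (hasSum_returnPowers step hn (by rw [hrn]; exact hn.summable) k).1
  have hcomp : ∀ k, HasSum (fun w : returnPowers step s k => z ^ (w : List A).length) (c ^ k) :=
    fun k => (hasSum_returnPowers step hc (by rw [hz]; exact hn.summable) k).1
  have hsum : Summable fun p : Σ k, returnPowers step s k =>
      ‖φ p.1‖ * r ^ (p.2 : List A).length := by
    refine (summable_sigma_of_nonneg (β := fun k => returnPowers step s k)
      (f := fun p => ‖φ p.1‖ * r ^ (p.2 : List A).length) fun _ => by positivity).2 ?_
    refine ⟨fun k => ((hreal k).mul_left ‖φ k‖).summable, hφn.congr fun k => ?_⟩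
    exact ((hreal k).mul_left ‖φ k‖).tsum_eq.symm
  have hterm : HasSum (fun p : Σ k, returnPowers step s k => φ p.1 * z ^ (p.2 : List A).length)
      σ := by
    refine HasSum.sigma_of_hasSum (γ := fun k => returnPowers step s k) hφ (fun k => (hcomp k).mul_left (φ k)) ?_
    refine Summable.of_norm (hsum.congr fun p => ?_)
    rw [norm_mul, norm_pow, hz]
  rw [← ψ.hasSum_iff]
  refine hterm.congr_fun fun p => ?_
  rw [Function.comp_apply, hψ, visits_of_mem_returnPowers step p.2.2]

end Automaton

/-! ### Counting words by length -/

section Length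

variable {A S : Type*} [Fintype A]

theorem hasSum_ofFn {F : Type*} [NormedAddCommGroup F] [CompleteSpace F] {f : List A → F} {σ : F}
    (h : HasSum f σ) : HasSum (fun n => ∑ w : Fin n → A, f (List.ofFn w)) σ := by
  have h1 := (List.equivSigmaTuple (α := A)).symm.hasSum_iff.2 h
  exact h1.sigma fun n => hasSum_fintype fun w : Fin n → A => f (List.ofFn w)

theorem summable_of_sum_ofFn_le {f : List A → ℝ} (hf : ∀ w, 0 ≤ f w) {B : ℝ}
    (hB : ∀ N, ∑ n ∈ Finset.range N, ∑ w : Fin n → A, f (List.ofFn w) ≤ B) :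
    Summable f ∧ ∑' w, f w ≤ B := by
  have hout : Summable fun n => ∑ w : Fin n → A, f (List.ofFn w) :=
    summable_of_sum_range_le (fun n => Finset.sum_nonneg fun _ _ => hf _) hB
  have hs : Summable f := by
    rw [← (List.equivSigmaTuple (α := A)).symm.summable_iff]
    refine (summable_sigma_of_nonneg (β := fun n => Fin n → A)
      (f := fun p => f (List.ofFn p.2)) fun _ => hf _).2 ⟨fun n => (hasSum_fintype _).summable, ?_⟩
    refine hout.congr fun n => ?_
    exact (tsum_fintype fun w : Fin n → A => f (List.ofFn w)).symm
  refine ⟨hs, ?_⟩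
  rw [← (hasSum_ofFn hs.hasSum).tsum_eq]
  exact Real.tsum_le_of_sum_range_le (fun n => Finset.sum_nonneg fun _ _ => hf _) hB

theorem sum_run_succ (step : A → S → Option S) (f : S → ℝ) (n : ℕ) (s : S) :
    ∑ w : Fin (n + 1) → A, (run step (List.ofFn w) s).elim 0 f =
      ∑ a, (step a s).elim 0 fun t => ∑ w : Fin n → A, (run step (List.ofFn w) t).elim 0 f := by
  rw [← (Fin.consEquiv fun _ => A).sum_comp, Fintype.sum_prod_type]
  refine Finset.sum_congr rfl fun a _ => ?_
  have hw : ∀ w : Fin n → A, List.ofFn (Fin.consEquiv (fun _ => A) (a, w)) = a :: List.ofFn w :=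
    fun w => List.ofFn_cons a w
  simp only [hw, run]
  cases step a s <;> simp

/-- `Ψ` is superharmonic with source `f` for the walk with weight `r` per letter; iterating the
inequality bounds the Green potential of `f` by `Ψ`. No convergence has to be known beforehand. -/
theorem sum_run_le_of_superharmonic (step : A → S → Option S) {f Ψ : S → ℝ} {r : ℝ}
    (hr : 0 ≤ r) (hΨ : ∀ s, 0 ≤ Ψ s)
    (h : ∀ s, f s + r * ∑ a, (step a s).elim 0 Ψ ≤ Ψ s) (N : ℕ) (s : S) :
    ∑ n ∈ Finset.range N, r ^ n * ∑ w : Fin n → A, (run step (List.ofFn w) s).elim 0 f ≤ Ψ s := by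
  induction N generalizing s with
  | zero => simpa using hΨ s
  | succ N ih =>
    refine le_trans ?_ (h s)
    rw [Finset.sum_range_succ']
    have h0 : r ^ 0 * ∑ w : Fin 0 → A, (run step (List.ofFn w) s).elim 0 f = f s := by
      simp [run]
    rw [h0, add_comm]
    gcongr
    simp only [sum_run_succ, pow_succ', mul_assoc, ← Finset.mul_sum]
    refine mul_le_mul_of_nonneg_left ?_ hr
    simp only [Finset.mul_sum]
    rw [Finset.sum_comm]
    refine Finset.sum_le_sum fun a _ => ?_
    cases step a s with
    | none => simp
    | some t => simpa [Finset.mul_sum] using ih t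

/-- The Green potential of the indicator of `s₀`, evaluated at `s₀`, is the generating function of
the loops. -/
theorem summable_returns (step : A → S → Option S) {Ψ : S → ℝ} {r : ℝ} (s₀ : S)
    (hr : 0 ≤ r) (hΨ : ∀ s, 0 ≤ Ψ s) (h₀ : 1 + r * ∑ a, (step a s₀).elim 0 Ψ ≤ Ψ s₀)
    (h : ∀ s, s ≠ s₀ → r * ∑ a, (step a s).elim 0 Ψ ≤ Ψ s) :
    Summable (fun w : returns step s₀ => r ^ (w : List A).length) ∧
      ∑' w : returns step s₀, r ^ (w : List A).length ≤ Ψ s₀ := by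
  classical
  have key := sum_run_le_of_superharmonic step (f := fun s => if s = s₀ then 1 else 0) hr hΨ
    (fun s => by
      split_ifs with hs
      · rw [hs]; exact h₀
      · rw [zero_add]; exact h s hs)
  have := summable_of_sum_ofFn_le
    (f := (returns step s₀).indicator fun w : List A => r ^ w.length)
    (fun w => Set.indicator_nonneg (fun _ _ => by positivity) _) (B := Ψ s₀) fun N => by
      refine le_trans (le_of_eq ?_) (key N s₀)
      refine Finset.sum_congr rfl fun n _ => ?_
      rw [Finset.mul_sum]
      refine Finset.sum_congr rfl fun w _ => ?_
      by_cases hw : run step (List.ofFn w) s₀ = some s₀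
      · rw [Set.indicator_of_mem (show List.ofFn w ∈ returns step s₀ from hw)]
        simp [hw]
      · rw [Set.indicator_of_notMem (show List.ofFn w ∉ returns step s₀ from hw)]
        cases hc : run step (List.ofFn w) s₀ with
        | none => simp
        | some t =>
          have : t ≠ s₀ := fun h' => hw (by rw [hc, h'])
          simp [this]
  refine ⟨summable_subtype_iff_indicator.2 this.1, ?_⟩
  rw [tsum_subtype (returns step s₀) fun w : List A => r ^ w.length]
  exact this.2

end Length

/-! ### Windows of periodic sequences -/

section Periodic

variable {A : Type*}

/-- The word of length `n` at position `i`, as a list. -/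
def listAt (x : ℤ → A) (i : ℤ) (n : ℕ) : List A := List.ofFn (wordAt x i n)

@[simp] theorem length_listAt (x : ℤ → A) (i : ℤ) (n : ℕ) : (listAt x i n).length = n := by
  simp [listAt]

@[simp] theorem listAt_zero (x : ℤ → A) (i : ℤ) : listAt x i 0 = [] := rfl

theorem listAt_add (x : ℤ → A) (i : ℤ) (m n : ℕ) :
    listAt x i (m + n) = listAt x i m ++ listAt x (i + m) n := by
  refine List.ext_getElem (by simp) fun k h1 h2 => ?_
  simp only [listAt, List.getElem_append, List.length_ofFn, List.getElem_ofFn, wordAt]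
  split_ifs with h
  · rfl
  · congr 1
    push_cast [not_lt.1 h]
    ring

theorem listAt_succ (x : ℤ → A) (i : ℤ) (n : ℕ) :
    listAt x i (n + 1) = x i :: listAt x (i + 1) n := by
  rw [add_comm, listAt_add]
  simp [listAt, wordAt]

theorem listAt_of_periodic {x : ℤ → A} {n : ℕ} (hx : ∀ i, x (i + n) = x i) (i : ℤ) (m : ℕ) :
    listAt x (i + n) m = listAt x i m := by
  unfold listAt wordAt
  congr 1
  funext k
  rw [← hx (i + _)]
  congr 1
  ring

theorem listAt_shift (x : ℤ → A) (j i : ℤ) (n : ℕ) :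
    listAt (fun k => x (j + k)) i n = listAt x (j + i) n := by
  unfold listAt wordAt
  simp only [add_assoc]

/-- The sequences of period `n` correspond to the words of length `n`. -/
def periodicEquiv (A : Type*) (n : ℕ) [NeZero n] :
    {x : ℤ → A // ∀ i, x (i + n) = x i} ≃ (Fin n → A) where
  toFun x := wordAt x.1 0 n
  invFun w := ⟨fun i => w ⟨(i % n).toNat, by
      have h := Int.emod_lt_of_pos i (b := n) (by exact_mod_cast NeZero.pos n)
      have h' := Int.emod_nonneg i (b := n) (by exact_mod_cast NeZero.ne n)
      omega⟩, fun i => by simp⟩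
  left_inv x := by
    ext i
    have hper : Function.Periodic x.1 (n : ℤ) := x.2
    have h' := Int.emod_nonneg i (b := n) (by exact_mod_cast NeZero.ne n)
    simp only [wordAt, zero_add]
    rw [Int.toNat_of_nonneg h', Int.emod_def, mul_comm]
    simpa using hper.sub_int_mul_eq (x := i) (i / n)
  right_inv w := by
    funext k
    have hk : ((k : ℕ) : ℤ) % n = (k : ℕ) := Int.emod_eq_of_lt (by positivity) (by exact_mod_cast k.2)
    simp [wordAt, hk]

theorem finite_periodic (A : Type*) [Finite A] (n : ℕ) [NeZero n] :
    {x : ℤ → A | ∀ i, x (i + n) = x i}.Finite := by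
  have : Finite {x : ℤ → A // ∀ i, x (i + n) = x i} := Finite.of_equiv _ (periodicEquiv A n).symm
  exact Set.finite_coe_iff.1 this

variable {S : Type*} (step : A → S → Option S) (s : S)

/-- The sequences of period `n` in which some window of length `n` leads from `s` to `s`. -/
def cyclicPoints (n : ℕ) : Set (ℤ → A) :=
  {x | (∀ i, x (i + n) = x i) ∧ ∃ i, listAt x i n ∈ returns step s}

/-- A rotation of a word that leads from `s` to `s` does so, too, only if it starts at a visit
to `s`. -/
def IsCircular : Prop :=
  ∀ u v : List A, u ++ v ∈ returns step s → v ++ u ∈ returns step s → u ∈ returns step s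

variable {step s}

/-- The window at `i` is the rotation `v ++ u` of the window `u ++ v` at `0`. Circularity yields one
direction; for the other, `u` and `u ++ v` return, hence so do `v` and `v ++ u`. -/
theorem listAt_mem_returns_iff (hcirc : IsCircular step s) {x : ℤ → A} {n : ℕ}
    (hx : ∀ i, x (i + n) = x i) (h0 : listAt x 0 n ∈ returns step s) {i : ℕ} (hi : i < n) :
    listAt x i n ∈ returns step s ↔ (listAt x 0 n).take i ∈ returns step s := by
  obtain ⟨j, rfl⟩ := Nat.exists_eq_add_of_le hi.le
  have h1 : listAt x 0 (i + j) = listAt x 0 i ++ listAt x i j := by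
    rw [listAt_add, zero_add]
  have h2 : listAt x i (i + j) = listAt x i j ++ listAt x 0 i := by
    rw [add_comm i j, listAt_add, ← listAt_of_periodic hx 0 i]
    congr 2
    push_cast
    ring
  have h3 : (listAt x 0 (i + j)).take i = listAt x 0 i := by
    rw [h1, List.take_append_of_le_length (by simp), List.take_of_length_le (by simp)]
  rw [h3, h2]
  rw [h1] at h0
  constructor
  · exact hcirc _ _ h0
  · intro hu
    exact (append_mem_returns ((append_mem_returns hu).1 h0)).2 hu

open Classical in
/-- The number of windows of length `n` per period that lead from `s` to `s`. -/
noncomputable def markers (step : A → S → Option S) (s : S) (n : ℕ) (x : ℤ → A) : ℕ :=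
  ((Finset.range n).filter fun i : ℕ => listAt x i n ∈ returns step s).card

theorem markers_eq_visits (hcirc : IsCircular step s) {x : ℤ → A} {n : ℕ}
    (hx : ∀ i, x (i + n) = x i) (h0 : listAt x 0 n ∈ returns step s) :
    markers step s n x = visits step s (listAt x 0 n) := by
  classical
  unfold markers visits
  rw [length_listAt]
  exact congrArg Finset.card (Finset.filter_congr fun i hi =>
    listAt_mem_returns_iff hcirc hx h0 (Finset.mem_range.1 hi))

theorem markers_shift {x : ℤ → A} {n : ℕ} (hx : ∀ i, x (i + n) = x i) (j : ℕ) :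
    markers step s n (fun k => x (j + k)) = markers step s n x := by
  classical
  -- The marked positions have period `n`, so the blocks starting at `0` and at `j` contain equally
  -- many of them.
  have hper : Function.Periodic (fun i : ℕ => listAt x i n ∈ returns step s) n := by
    intro i
    simp only [Nat.cast_add, listAt_of_periodic hx]
  unfold markers
  rw [← Nat.count_eq_card_filter_range (fun i : ℕ => listAt x (i : ℤ) n ∈ returns step s),
    ← Nat.filter_Ico_card_eq_of_periodic j n _ hper]
  refine Finset.card_bij (fun i _ => j + i) ?_ ?_ ?_
  · intro i hi
    simp only [Finset.mem_filter, Finset.mem_range, listAt_shift] at hi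
    simp only [Finset.mem_filter, Finset.mem_Ico]
    refine ⟨by omega, ?_⟩
    push_cast
    exact hi.2
  · intro a _ b _ h
    omega
  · intro i hi
    simp only [Finset.mem_filter, Finset.mem_Ico] at hi
    refine ⟨i - j, ?_, by omega⟩
    simp only [Finset.mem_filter, Finset.mem_range, listAt_shift]
    refine ⟨by omega, ?_⟩
    rw [Nat.cast_sub hi.1.1, add_sub_cancel]
    exact hi.2

theorem exists_nat_listAt_mem {x : ℤ → A} {n : ℕ} [NeZero n] (hx : ∀ i, x (i + n) = x i)
    (h : ∃ i : ℤ, listAt x i n ∈ returns step s) :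
    ∃ i : ℕ, i < n ∧ listAt x i n ∈ returns step s := by
  obtain ⟨i, hi⟩ := h
  have h1 := Int.emod_lt_of_pos i (b := n) (by exact_mod_cast NeZero.pos n)
  have h2 := Int.emod_nonneg i (b := n) (by exact_mod_cast NeZero.ne n)
  have hper : Function.Periodic (fun i : ℤ => listAt x i n) (n : ℤ) :=
    fun i => listAt_of_periodic hx i n
  refine ⟨(i % n).toNat, by omega, ?_⟩
  rw [Int.toNat_of_nonneg h2, Int.emod_def, mul_comm]
  have := hper.sub_int_mul_eq (x := i) (i / n)
  simp only [Int.cast_id] at this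
  rwa [this]

open Classical in
/-- Every cyclic class of sequences is counted through its windows that lead from `s` to `s`. -/
theorem ncard_cyclicPoints [Fintype A] (hcirc : IsCircular step s) (n : ℕ) [NeZero n] :
    ((cyclicPoints step s n).ncard : ℂ) = n * ∑ w : Fin n → A,
      (if List.ofFn w ∈ returns step s then (1 / (visits step s (List.ofFn w) : ℂ)) else 0) := by
  set P := (finite_periodic A n).toFinset with hP
  have hmemP : ∀ x, x ∈ P ↔ ∀ i, x (i + n) = x i := fun x => by simp [hP]
  have hcard : ((cyclicPoints step s n).ncard : ℂ) =
      ∑ x ∈ P, if ∃ i : ℤ, listAt x i n ∈ returns step s then (1 : ℂ) else 0 := by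
    rw [Finset.sum_boole, ← Set.ncard_coe_finset]
    congr 2
    ext x
    simp [cyclicPoints, hmemP]
  -- The unit weight of a point is spread evenly over its marked positions in one period.
  have hone : ∀ x ∈ P, (if ∃ i : ℤ, listAt x i n ∈ returns step s then (1 : ℂ) else 0) =
      ∑ i ∈ Finset.range n,
        if listAt x i n ∈ returns step s then (1 / (markers step s n x : ℂ)) else 0 := by
    intro x hx
    rw [← Finset.sum_filter, Finset.sum_const, nsmul_eq_mul]
    change _ = (markers step s n x : ℂ) * _
    split_ifs with h
    · obtain ⟨i, hi, hm⟩ := exists_nat_listAt_mem ((hmemP x).1 hx) h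
      have : markers step s n x ≠ 0 :=
        Finset.card_ne_zero_of_mem (Finset.mem_filter.2 ⟨Finset.mem_range.2 hi, hm⟩)
      field_simp
    · have : markers step s n x = 0 := by
        rw [markers, Finset.card_eq_zero, Finset.filter_eq_empty_iff]
        exact fun i _ hm => h ⟨i, hm⟩
      simp [this]
  -- Rotation by `i` permutes the periodic points and preserves the number of markers, so every
  -- position contributes as much as position `0`; this gives the factor `n`.
  have hshift : ∀ i ∈ Finset.range n,
      (∑ x ∈ P, if listAt x i n ∈ returns step s then (1 / (markers step s n x : ℂ)) else 0) =
      ∑ x ∈ P, if listAt x 0 n ∈ returns step s then (1 / (markers step s n x : ℂ)) else 0 := by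
    intro i _
    refine Finset.sum_bij' (fun x _ k => x (i + k)) (fun x _ k => x (-i + k)) ?_ ?_ ?_ ?_ ?_
    · intro x hx
      rw [hmemP] at hx ⊢
      intro k
      rw [← add_assoc, hx]
    · intro x hx
      rw [hmemP] at hx ⊢
      intro k
      rw [← add_assoc, hx]
    · intro x _
      funext k
      simp
    · intro x _
      funext k
      simp
    · intro x hx
      rw [listAt_shift, add_zero, markers_shift ((hmemP x).1 hx)]
  -- A periodic point is determined by its window at `0`, and by circularity the markers are the
  -- visits of that window.
  have hword : (∑ x ∈ P, if listAt x 0 n ∈ returns step s then (1 / (markers step s n x : ℂ))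
      else 0) = ∑ w : Fin n → A,
      (if List.ofFn w ∈ returns step s then (1 / (visits step s (List.ofFn w) : ℂ)) else 0) := by
    let _ : Fintype {x : ℤ → A // ∀ i, x (i + n) = x i} :=
      Fintype.ofEquiv _ (periodicEquiv A n).symm
    rw [← (periodicEquiv A n).sum_comp]
    refine Finset.sum_bij' (fun x hx => ⟨x, (hmemP x).1 hx⟩) (fun x _ => x.1)
      (fun _ _ => Finset.mem_univ _) (fun x _ => (hmemP x.1).2 x.2) (fun _ _ => rfl)
      (fun _ _ => rfl) ?_
    intro x hx
    change _ = if listAt x 0 n ∈ returns step s then (1 / (visits step s (listAt x 0 n) : ℂ))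
      else 0
    split_ifs with h
    · rw [markers_eq_visits hcirc ((hmemP x).1 hx) h]
    · rfl
  rw [hcard, Finset.sum_congr rfl hone, Finset.sum_comm, Finset.sum_congr rfl hshift, hword]
  simp

/-- The zeta function of the periodic sequences with windows that lead from `s` to `s`. -/
theorem hasSum_cyclicPoints [Fintype A] (hcirc : IsCircular step s) {z c : ℂ} {r C : ℝ}
    (hz : ‖z‖ = r) (hc : HasSum (fun u : firstReturns step s => z ^ (u : List A).length) c)
    (hn : HasSum (fun u : firstReturns step s => r ^ (u : List A).length) C)
    (hC : C < 1) (hcC : ‖c‖ ≤ C) :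
    HasSum (fun n : ℕ => ((cyclicPoints step s (n + 1)).ncard : ℂ) * z ^ (n + 1) / (n + 1 : ℕ))
      (-Complex.log (1 - c)) := by
  classical
  have hC0 : 0 ≤ C := (norm_nonneg c).trans hcC
  -- The term `k = 0` vanishes because `1 / 0 = 0`; for the same reason the empty word has weight
  -- zero in `h0` below.
  have hφ : HasSum (fun k : ℕ => (1 / (k : ℂ)) * c ^ k) (-Complex.log (1 - c)) := by
    refine (Complex.hasSum_taylorSeries_neg_log (hcC.trans_lt hC)).congr_fun fun k => ?_
    ring
  have hφn : Summable fun k : ℕ => ‖1 / (k : ℂ)‖ * C ^ k := by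
    refine Summable.of_nonneg_of_le (fun _ => by positivity) (fun k => ?_)
      (summable_geometric_of_lt_one hC0 hC)
    refine mul_le_of_le_one_left (by positivity) ?_
    rcases Nat.eq_zero_or_pos k with rfl | hk
    · simp
    · rw [norm_div, norm_one, Complex.norm_natCast]
      exact div_le_one_of_le₀ (by exact_mod_cast hk) (by positivity)
  have h1 := hasSum_returns step (φ := fun k => 1 / (k : ℂ)) hz hc hn hφ hφn
  have h2 : HasSum ((returns step s).indicator fun w : List A =>
      1 / (visits step s w : ℂ) * z ^ w.length) (-Complex.log (1 - c)) :=
    hasSum_subtype_iff_indicator.1 h1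
  have h3 := (hasSum_nat_add_iff' 1).2 (hasSum_ofFn h2)
  have h0 : ∑ n ∈ Finset.range 1, ∑ w : Fin n → A, ((returns step s).indicator
      (fun w : List A => 1 / (visits step s w : ℂ) * z ^ w.length) (List.ofFn w)) = 0 := by
    simp [Set.indicator, visits]
  rw [h0, sub_zero] at h3
  refine h3.congr_fun fun n => ?_
  rw [ncard_cyclicPoints hcirc, mul_assoc, mul_div_assoc, mul_comm, div_mul_cancel₀, Finset.sum_mul]
  · refine Finset.sum_congr rfl fun w _ => ?_
    simp [Set.indicator]
  · exact_mod_cast n.succ_ne_zero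

end Periodic

/-! ### Words with a non-zero product and stack automata -/

section Stack

variable {V E : Type*}

/-- The involution that exchanges `e⁻` and `e⁺`. -/
def Letter.flip : Letter E → Letter E
  | .minus e => .plus e
  | .plus e => .minus e

@[simp] theorem Letter.flip_flip (a : Letter E) : a.flip.flip = a := by
  cases a <;> rfl

/-- The initial vertex of a letter. -/
def Letter.source (G : DirectedGraph V E) : Letter E → V
  | .minus e => G.s e
  | .plus e => G.r e

variable [DecidableEq V] [DecidableEq E] (G : DirectedGraph V E)

/-- The stack automaton: `e⁻` pushes `e` and `e⁺` pops it; the first entry of a state is the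
current vertex. If `b` is true, an arbitrary edge may be popped from the empty stack. -/
def stackStep (b : Bool) : Letter E → V × List E → Option (V × List E)
  | .minus f, (v, σ) => if v = G.s f then some (G.r f, f :: σ) else none
  | .plus f, (v, []) => if b = true ∧ v = G.r f then some (G.s f, []) else none
  | .plus f, (v, e :: σ) => if e = f ∧ v = G.r f then some (G.s f, σ) else none

theorem eq_source_of_stackStep {b : Bool} {a : Letter E} {s t : V × List E}
    (h : stackStep G b a s = some t) : s.1 = a.source G := by
  obtain ⟨v, σ⟩ := s
  rcases a with f | f
  · simp only [stackStep] at h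
    split_ifs at h with hv
    exact hv
  · cases σ <;> simp only [stackStep] at h <;> split_ifs at h with hv <;> exact hv.2

/-- Strict letters act as partial injections, and the two letters of an edge are inverse to each
other. An unmatched pop would destroy this. -/
theorem stackStep_false_iff_flip (a : Letter E) (s t : V × List E) :
    stackStep G false a s = some t ↔ stackStep G false a.flip t = some s := by
  obtain ⟨v, σ⟩ := s
  obtain ⟨w, τ⟩ := t
  rcases a with f | f
  · cases τ with
    | nil => simp [stackStep, Letter.flip]
    | cons e τ =>
      simp only [stackStep, Letter.flip, Option.ite_none_right_eq_some, Option.some.injEq,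
        Prod.mk.injEq, List.cons.injEq]
      grind
  · cases σ with
    | nil => simp [stackStep, Letter.flip]
    | cons e σ =>
      simp only [stackStep, Letter.flip, Option.ite_none_right_eq_some, Option.some.injEq,
        Prod.mk.injEq, List.cons.injEq]
      grind

theorem run_false_iff_reverse (w : List (Letter E)) (s t : V × List E) :
    run (stackStep G false) w s = some t ↔
      run (stackStep G false) (w.reverse.map Letter.flip) t = some s := by
  induction w generalizing s with
  | nil => simp [run, eq_comm]
  | cons a w ih =>
    simp only [run, List.reverse_cons, List.map_append, run_append, List.map_cons, List.map_nil,
      Option.bind_eq_some_iff]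
    refine exists_congr fun u => ?_
    rw [ih, stackStep_false_iff_flip, and_comm]
    simp

/-- Longer stacks do not obstruct a run. -/
theorem run_append_stack {b b' : Bool} {w : List (Letter E)} {v v' v'' : V} {σ σ' τ ρ : List E}
    (h : run (stackStep G b) w (v, σ) = some (v', σ'))
    (h' : run (stackStep G b') w (v, σ ++ τ) = some (v'', ρ)) :
    v'' = v' ∧ ∃ τ', ρ = σ' ++ τ' := by
  induction w generalizing v σ τ with
  | nil =>
    simp only [run, Option.some.injEq, Prod.mk.injEq] at h h'
    exact ⟨h'.1.symm.trans h.1, τ, by rw [← h'.2, h.2]⟩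
  | cons a w ih =>
    simp only [run, Option.bind_eq_some_iff] at h h'
    obtain ⟨⟨x, α⟩, h1, h⟩ := h
    obtain ⟨⟨y, β⟩, h1', h'⟩ := h'
    suffices y = x ∧ ∃ τ', β = α ++ τ' by
      obtain ⟨rfl, τ', rfl⟩ := this
      exact ih h h'
    rcases a with f | f
    · simp only [stackStep, Option.ite_none_right_eq_some, Option.some.injEq,
        Prod.mk.injEq] at h1 h1'
      obtain ⟨-, rfl, rfl⟩ := h1
      obtain ⟨-, rfl, rfl⟩ := h1'
      exact ⟨rfl, τ, rfl⟩
    · cases σ with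
      | nil =>
        simp only [stackStep, Option.ite_none_right_eq_some, Option.some.injEq,
          Prod.mk.injEq] at h1
        obtain ⟨-, rfl, rfl⟩ := h1
        cases τ with
        | nil =>
          simp only [stackStep, List.append_nil, Option.ite_none_right_eq_some,
            Option.some.injEq, Prod.mk.injEq] at h1'
          obtain ⟨-, rfl, rfl⟩ := h1'
          exact ⟨rfl, [], rfl⟩
        | cons g τ =>
          simp only [stackStep, List.nil_append, Option.ite_none_right_eq_some,
            Option.some.injEq, Prod.mk.injEq] at h1'
          obtain ⟨-, rfl, rfl⟩ := h1'
          exact ⟨rfl, _, rfl⟩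
      | cons g σ =>
        simp only [stackStep, List.cons_append, Option.ite_none_right_eq_some, Option.some.injEq,
          Prod.mk.injEq] at h1 h1'
        obtain ⟨-, rfl, rfl⟩ := h1
        obtain ⟨-, rfl, rfl⟩ := h1'
        exact ⟨rfl, τ, rfl⟩

/-- The edges popped from the empty stack are placed beforehand at the bottom of the stack, in the
order in which they are popped. -/
theorem exists_run_false_of_run {b : Bool} {w : List (Letter E)} {v : V} {σ : List E}
    {t : V × List E} (h : run (stackStep G b) w (v, σ) = some t) :
    ∃ τ t', run (stackStep G false) w (v, σ ++ τ) = some t' := by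
  induction w generalizing v σ with
  | nil => exact ⟨[], _, rfl⟩
  | cons a w ih =>
    simp only [run, Option.bind_eq_some_iff] at h ⊢
    obtain ⟨⟨y, β⟩, h1, h⟩ := h
    obtain ⟨τ, t', h'⟩ := ih h
    have hv := eq_source_of_stackStep G h1
    simp only at hv
    subst hv
    rcases a with f | f
    · simp only [stackStep, Letter.source, Option.ite_none_right_eq_some, Option.some.injEq,
        Prod.mk.injEq] at h1 ⊢
      obtain ⟨-, rfl, rfl⟩ := h1
      exact ⟨τ, t', _, ⟨trivial, rfl⟩, h'⟩
    · cases σ with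
      | nil =>
        simp only [stackStep, Letter.source, Option.ite_none_right_eq_some, Option.some.injEq,
          Prod.mk.injEq] at h1
        obtain ⟨-, rfl, rfl⟩ := h1
        exact ⟨f :: τ, t', _, by simp [stackStep, Letter.source], h'⟩
      | cons g σ =>
        simp only [stackStep, Letter.source, Option.ite_none_right_eq_some,
          Option.some.injEq, Prod.mk.injEq] at h1
        obtain ⟨⟨rfl, -⟩, rfl, rfl⟩ := h1
        exact ⟨τ, t', _, by simp [stackStep, Letter.source], h'⟩

/-! ### The representation of the graph inverse semigroup by stack operations -/

/-- The pull-back of functions along a partial map. -/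
def pullback {S : Type*} (p : S → Option S) : Module.End ℤ (S → ℤ) where
  toFun f s := (p s).elim 0 f
  map_add' f g := by
    funext s
    cases h : p s <;> simp [h]
  map_smul' c f := by
    funext s
    cases h : p s <;> simp [h]

/-- Pull-back reverses composition, so a product of operators reads its word from left to right.
Passing to linear operators makes the nowhere defined map an absorbing zero. -/
theorem pullback_mul {S : Type*} (p q : S → Option S) :
    pullback p * pullback q = pullback fun s => (p s).bind q := by
  ext f s
  simp only [Module.End.mul_apply, pullback, LinearMap.coe_mk, AddHom.coe_mk]
  cases p s <;> rfl

theorem pullback_none {S : Type*} : pullback (fun _ : S => none) = 0 := by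
  ext f s
  rfl

/-- The action of the generators on stacks. -/
def genStep : Gen V E → V × List E → Option (V × List E)
  | .letter a => stackStep G false a
  | .vertex v => fun s => if s.1 = v then some s else none

/-- The representation of the free monoid with zero by stack operations. -/
noncomputable def freeRep : FreeWithZero V E →*₀ Module.End ℤ (V × List E → ℤ) :=
  WithZero.lift' (FreeMonoid.lift fun g => pullback (genStep G g))

theorem freeRep_P (v : V) : freeRep G (P E v) = pullback (genStep G (.vertex v)) := by
  simp [freeRep, P, WithZero.lift'_coe]

theorem freeRep_em (e : E) : freeRep G (em V e) = pullback (stackStep G false (.minus e)) := by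
  simp [freeRep, em, WithZero.lift'_coe, genStep]

theorem freeRep_ep (e : E) : freeRep G (ep V e) = pullback (stackStep G false (.plus e)) := by
  simp [freeRep, ep, WithZero.lift'_coe, genStep]

theorem freeRep_eq_of_inverseRel {x y : FreeWithZero V E} (h : InverseRel G x y) :
    freeRep G x = freeRep G y := by
  -- Every relation involves at most two generators, so it suffices to distinguish the two top
  -- entries of the stack.
  induction h <;>
    simp only [map_mul, map_zero, freeRep_P, freeRep_em, freeRep_ep, pullback_mul,
      ← pullback_none] <;>
    congr 1 <;> funext ⟨v, σ⟩ <;> rcases σ with _ | ⟨e, _ | ⟨e', σ⟩⟩ <;> simp only [genStep, stackStep] <;>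
    grind [stackStep]

/-- The representation of the graph inverse semigroup by stack operations. -/
noncomputable def stackRep : GraphInverseSemigroup G →* Module.End ℤ (V × List E → ℤ) :=
  (conGen (InverseRel G)).lift (freeRep G : FreeWithZero V E →* Module.End ℤ (V × List E → ℤ))
    (Con.conGen_le.2 fun _ _ h => (Con.ker_rel _).2 (freeRep_eq_of_inverseRel G h))

theorem stackRep_prod (w : List (Letter E)) :
    stackRep G (w.map (letterElt G)).prod = pullback (run (stackStep G false) w) := by
  induction w with
  | nil =>
    rw [List.map_nil, List.prod_nil, map_one]
    ext f s
    rfl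
  | cons a w ih =>
    rw [List.map_cons, List.prod_cons, map_mul, ih]
    have : stackRep G (letterElt G a) = pullback (stackStep G false a) := by
      rcases a with e | e
      · exact freeRep_em G e
      · exact freeRep_ep G e
    rw [this, pullback_mul]
    rfl

/-- The zero acts as the zero operator, whereas the pull-back of the constant function `1` along the
run has value `1` at `s`. -/
theorem prod_ne_zeroElt_of_run {w : List (Letter E)} {s t : V × List E}
    (h : run (stackStep G false) w s = some t) : (w.map (letterElt G)).prod ≠ zeroElt G := by
  intro h0
  have h1 := stackRep_prod G w
  have hz : stackRep G (zeroElt G) = 0 := map_zero (freeRep G)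
  rw [h0, hz] at h1
  have h2 := congrFun (LinearMap.congr_fun h1 1) s
  simp [pullback, h] at h2

end Stack

/-! ### Zero products in the graph inverse semigroup -/

section Relations

variable {V E : Type*} (G : DirectedGraph V E)

/-- The idempotent of a vertex. -/
def vertexElt (v : V) : GraphInverseSemigroup G := (conGen (InverseRel G)).toQuotient (P E v)

theorem toQuotient_eq {x y : FreeWithZero V E} (h : InverseRel G x y) :
    (conGen (InverseRel G)).toQuotient x = (conGen (InverseRel G)).toQuotient y :=
  (Con.eq _).2 (ConGen.Rel.of _ _ h)

theorem zeroElt_mul (x : GraphInverseSemigroup G) : zeroElt G * x = zeroElt G := by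
  induction x using Con.induction_on with
  | H x => exact congrArg (conGen (InverseRel G)).toQuotient (zero_mul x)

theorem mul_zeroElt (x : GraphInverseSemigroup G) : x * zeroElt G = zeroElt G := by
  induction x using Con.induction_on with
  | H x => exact congrArg (conGen (InverseRel G)).toQuotient (mul_zero x)

theorem vertexElt_mul_letterElt (a : Letter E) :
    vertexElt G (a.source G) * letterElt G a = letterElt G a := by
  rcases a with e | e
  · exact toQuotient_eq G (.source_mul_minus e)
  · exact toQuotient_eq G (.range_mul_plus e)

theorem vertexElt_mul_of_ne {v : V} {a : Letter E} (h : v ≠ a.source G) :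
    vertexElt G v * letterElt G a = zeroElt G := by
  rw [← vertexElt_mul_letterElt, ← mul_assoc]
  have : vertexElt G v * vertexElt G (a.source G) = zeroElt G :=
    toQuotient_eq G (.vertex_mul_vertex _ _ h)
  rw [this, zeroElt_mul]

/-- The element that pushes a stack. -/
def stackElt (s : V × List E) : GraphInverseSemigroup G :=
  (s.2.reverse.map fun e => letterElt G (.minus e)).prod * vertexElt G s.1

variable [DecidableEq V] [DecidableEq E]

theorem stackElt_mul_of_none {a : Letter E} {s : V × List E} (h : stackStep G true a s = none) :
    stackElt G s * letterElt G a = zeroElt G := by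
  obtain ⟨v, σ⟩ := s
  by_cases hv : v = a.source G
  · subst hv
    rcases a with f | f
    · simp [stackStep, Letter.source] at h
    · cases σ with
      | nil => simp [stackStep, Letter.source] at h
      | cons e σ =>
        have hef : e ≠ f := by simpa [stackStep, Letter.source] using h
        have h0 : letterElt G (.minus e) * letterElt G (.plus f) = zeroElt G :=
          toQuotient_eq G (.minus_mul_plus_of_ne e f hef)
        simp only [stackElt, List.reverse_cons, List.map_append, List.map_cons, List.map_nil,
          List.prod_append, List.prod_singleton, mul_assoc, vertexElt_mul_letterElt, h0,
          mul_zeroElt]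
  · rw [stackElt, mul_assoc, vertexElt_mul_of_ne G hv, mul_zeroElt]

/-- The left factor `q` records an unmatched pop and is `1` otherwise. It does no harm, as only the
vanishing of products from some point on is to be propagated. -/
theorem stackElt_mul_of_some {a : Letter E} {s t : V × List E}
    (h : stackStep G true a s = some t) :
    ∃ q, stackElt G s * letterElt G a = q * stackElt G t := by
  obtain ⟨v, σ⟩ := s
  obtain rfl : v = a.source G := eq_source_of_stackStep G h
  rcases a with f | f
  · simp only [stackStep, Letter.source, if_true, Option.some.injEq] at h
    subst h
    have h1 : letterElt G (.minus f) * vertexElt G (G.r f) = letterElt G (.minus f) :=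
      toQuotient_eq G (.minus_mul_range f)
    refine ⟨1, ?_⟩
    rw [stackElt, mul_assoc, vertexElt_mul_letterElt]
    simp [stackElt, mul_assoc, h1]
  · cases σ with
    | nil =>
      simp only [stackStep, Letter.source, and_self, if_true, Option.some.injEq] at h
      subst h
      have h1 : letterElt G (.plus f) * vertexElt G (G.s f) = letterElt G (.plus f) :=
        toQuotient_eq G (.plus_mul_source f)
      refine ⟨letterElt G (.plus f), ?_⟩
      rw [stackElt, mul_assoc, vertexElt_mul_letterElt]
      simp [stackElt, h1]
    | cons e σ =>
      simp only [stackStep, Letter.source, and_true, Option.ite_none_right_eq_some,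
        Option.some.injEq] at h
      obtain ⟨rfl, rfl⟩ := h
      have h1 : letterElt G (.minus e) * letterElt G (.plus e) = vertexElt G (G.s e) :=
        toQuotient_eq G (.minus_mul_plus e)
      refine ⟨1, ?_⟩
      rw [stackElt, mul_assoc, vertexElt_mul_letterElt]
      simp [stackElt, mul_assoc, h1]

theorem stackElt_mul_prod_of_none {w : List (Letter E)} {s : V × List E}
    (h : run (stackStep G true) w s = none) :
    stackElt G s * (w.map (letterElt G)).prod = zeroElt G := by
  induction w generalizing s with
  | nil => simp [run] at h
  | cons a w ih =>
    rw [List.map_cons, List.prod_cons, ← mul_assoc]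
    cases hs : stackStep G true a s with
    | none => rw [stackElt_mul_of_none G hs, zeroElt_mul]
    | some t =>
      obtain ⟨q, hq⟩ := stackElt_mul_of_some G hs
      rw [hq, mul_assoc, ih (by simpa [run, hs] using h), mul_zeroElt]

/-- A word has a non-zero product if and only if it can be read from some empty stack. -/
theorem prod_ne_zeroElt_iff [Nonempty V] (w : List (Letter E)) :
    (w.map (letterElt G)).prod ≠ zeroElt G ↔
      ∃ v t, run (stackStep G true) w (v, []) = some t := by
  constructor
  · intro h
    cases w with
    | nil => exact ⟨Classical.arbitrary V, _, rfl⟩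
    | cons a w =>
      refine ⟨a.source G, Option.ne_none_iff_exists'.1 fun h0 => h ?_⟩
      have := stackElt_mul_prod_of_none G h0
      rw [List.map_cons, List.prod_cons, ← mul_assoc, stackElt] at this
      simpa [vertexElt_mul_letterElt] using this
  · rintro ⟨v, t, h⟩
    obtain ⟨τ, t', h'⟩ := exists_run_false_of_run G h
    exact prod_ne_zeroElt_of_run G h'

end Relations

/-! ### Points and words of Markov-Dyck shifts -/

section Net

variable {E : Type*}

/-- The number of letters `e⁻` minus the number of letters `e⁺` of a word. -/
def net : List (Letter E) → ℤ
  | [] => 0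
  | .minus _ :: w => net w + 1
  | .plus _ :: w => net w - 1

theorem net_append (u w : List (Letter E)) : net (u ++ w) = net u + net w := by
  induction u with
  | nil => simp [net]
  | cons a u ih => cases a <;> simp only [List.cons_append, net, ih] <;> ring

theorem net_reverse_map_flip (w : List (Letter E)) :
    net (w.reverse.map Letter.flip) = -net w := by
  induction w with
  | nil => simp [net]
  | cons a w ih =>
    simp only [List.reverse_cons, List.map_append, List.map_cons, List.map_nil, net_append, ih]
    cases a <;> simp only [Letter.flip, net] <;> ring

theorem mem_markovDyckShift_iff {V : Type*} (G : DirectedGraph V E) (x : ℤ → Letter E) : x ∈ (markovDyckShift G).carrier ↔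
    ∀ i n, ((listAt x i n).map (letterElt G)).prod ≠ zeroElt G := by
  simp only [markovDyckShift, wordProd, listAt, List.map_ofFn]
  rfl

theorem listAt_rotate {A : Type*} {x : ℤ → A} {n : ℕ} (hx : ∀ i, x (i + n) = x i) {i : ℤ}
    {u w : List A} (h : listAt x i n = u ++ w) : listAt x (i + u.length) n = w ++ u := by
  have hlen := congrArg List.length h
  rw [length_listAt, List.length_append] at hlen
  have h' := h
  rw [hlen, listAt_add] at h'
  obtain ⟨hu, hw⟩ := List.append_inj h' (by simp)
  have : i + u.length + w.length = i + n := by rw [hlen]; push_cast; ring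
  rw [hlen, add_comm u.length, listAt_add, hw, this, listAt_of_periodic hx, hu]

theorem net_listAt {x : ℤ → Letter E} {n : ℕ} (hx : ∀ i, x (i + n) = x i) (i : ℤ) :
    net (listAt x i n) = net (listAt x 0 n) := by
  have hstep : ∀ i, net (listAt x (i + 1) n) = net (listAt x i n) := by
    intro i
    have h1 : listAt x i (n + 1) = listAt x i n ++ [x i] := by
      rw [listAt_add, listAt_succ, hx, listAt_zero]
    rw [listAt_succ] at h1
    have h2 := congrArg net h1
    have h3 := net_append [x i] (listAt x (i + 1) n)
    rw [List.singleton_append] at h3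
    rw [net_append, h3] at h2
    linarith
  induction i using Int.induction_on with
  | zero => rfl
  | succ k ih => rw [hstep, ih]
  | pred k ih => rw [← ih, ← hstep (-(k : ℤ) - 1), sub_add_cancel]

/-- The time reversal of a sequence. -/
def reversal (x : ℤ → Letter E) : ℤ → Letter E := fun i => (x (-i)).flip

theorem reversal_reversal (x : ℤ → Letter E) : reversal (reversal x) = x := by
  funext i
  simp [reversal]

theorem listAt_reversal (x : ℤ → Letter E) (i : ℤ) (n : ℕ) :
    listAt (reversal x) i n = (listAt x (-i - n + 1) n).reverse.map Letter.flip := by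
  refine List.ext_getElem (by simp) fun k h1 h2 => ?_
  simp only [length_listAt] at h1
  simp only [listAt, wordAt, reversal, List.getElem_ofFn, List.getElem_map, List.getElem_reverse,
    List.length_ofFn]
  congr 2
  have : ((n - 1 - k : ℕ) : ℤ) = n - 1 - k := by omega
  rw [this]
  ring

end Net

/-! ### Runs from an empty stack and heights of stacks -/

section Points

variable {V E : Type*} [DecidableEq V] [DecidableEq E] (G : DirectedGraph V E)

theorem run_append_of_run_false {b : Bool} {w : List (Letter E)} {v v' : V} {σ σ' : List E}
    (h : run (stackStep G false) w (v, σ) = some (v', σ')) (τ : List E) :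
    run (stackStep G b) w (v, σ ++ τ) = some (v', σ' ++ τ) := by
  induction w generalizing v σ with
  | nil =>
    simp only [run, Option.some.injEq, Prod.mk.injEq] at h ⊢
    simp [h]
  | cons a w ih =>
    simp only [run, Option.bind_eq_some_iff] at h ⊢
    obtain ⟨⟨x, α⟩, hu, h⟩ := h
    refine ⟨(x, α ++ τ), ?_, ih h⟩
    rcases a with f | f
    · simp only [stackStep, Option.ite_none_right_eq_some, Option.some.injEq, Prod.mk.injEq] at hu ⊢
      obtain ⟨h1, h2, rfl⟩ := hu
      exact ⟨h1, h2, rfl⟩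
    · cases σ with
      | nil => simp [stackStep] at hu
      | cons e σ =>
        simp only [stackStep, List.cons_append, Option.ite_none_right_eq_some, Option.some.injEq,
          Prod.mk.injEq] at hu ⊢
        obtain ⟨h1, h2, rfl⟩ := hu
        exact ⟨h1, h2, rfl⟩

theorem run_of_run_false {b : Bool} {w : List (Letter E)} {s t : V × List E}
    (h : run (stackStep G false) w s = some t) : run (stackStep G b) w s = some t := by
  simpa using run_append_of_run_false G (b := b) (σ := s.2) (σ' := t.2) h []

theorem length_add_net_of_run_false {w : List (Letter E)} {s t : V × List E}
    (h : run (stackStep G false) w s = some t) : (s.2.length : ℤ) + net w = t.2.length := by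
  induction w generalizing s with
  | nil =>
    simp only [run, Option.some.injEq] at h
    simp [net, h]
  | cons a w ih =>
    simp only [run, Option.bind_eq_some_iff] at h
    obtain ⟨u, hu, h⟩ := h
    rw [← ih h]
    obtain ⟨v, σ⟩ := s
    rcases a with f | f
    · simp only [stackStep, Option.ite_none_right_eq_some, Option.some.injEq] at hu
      obtain ⟨-, rfl⟩ := hu
      simp only [net, List.length_cons]
      push_cast
      ring
    · cases σ with
      | nil => simp [stackStep] at hu
      | cons e σ =>
        simp only [stackStep, Option.ite_none_right_eq_some, Option.some.injEq] at hu
        obtain ⟨-, rfl⟩ := hu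
        simp only [net, List.length_cons]
        push_cast
        ring

/-- Each unmatched pop lowers the net push but not the height. Hence the height exceeds the
prediction by the number of unmatched pops, and equality means that the run is strict. -/
theorem length_add_net_le_of_run {b : Bool} {w : List (Letter E)} {s t : V × List E}
    (h : run (stackStep G b) w s = some t) : (s.2.length : ℤ) + net w ≤ t.2.length ∧
      ((s.2.length : ℤ) + net w = t.2.length → run (stackStep G false) w s = some t) := by
  induction w generalizing s with
  | nil =>
    simp only [run, Option.some.injEq] at h
    simp [net, h, run]
  | cons a w ih =>
    simp only [run, Option.bind_eq_some_iff] at h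
    obtain ⟨u, hu, h⟩ := h
    obtain ⟨h1, h2⟩ := ih h
    obtain ⟨v, σ⟩ := s
    rcases a with f | f
    · have hu' := hu
      simp only [stackStep, Option.ite_none_right_eq_some, Option.some.injEq] at hu
      obtain ⟨-, rfl⟩ := hu
      simp only [List.length_cons] at h1 h2
      push_cast at h1 h2
      simp only [net]
      refine ⟨by linarith, fun h3 => ?_⟩
      rw [run, show stackStep G false (.minus f) (v, σ) = _ from hu']
      exact h2 (by linarith)
    · cases σ with
      | nil =>
        simp only [stackStep, Option.ite_none_right_eq_some, Option.some.injEq] at hu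
        obtain ⟨-, rfl⟩ := hu
        simp only [List.length_nil, net] at h1 h2 ⊢
        exact ⟨by linarith, fun h3 => by exfalso; push_cast at *; linarith⟩
      | cons e σ =>
        have hu' := hu
        simp only [stackStep, Option.ite_none_right_eq_some, Option.some.injEq] at hu
        obtain ⟨-, rfl⟩ := hu
        simp only [List.length_cons, net]
        push_cast
        refine ⟨by linarith, fun h3 => ?_⟩
        rw [run, show stackStep G false (.plus f) (v, e :: σ) = _ from hu']
        exact h2 (by linarith)

/-- A run is strict, or it pops an edge from the empty stack. -/
theorem run_false_or_exists_pop {b : Bool} {w : List (Letter E)} {s t : V × List E}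
    (h : run (stackStep G b) w s = some t) : run (stackStep G false) w s = some t ∨
      ∃ u f u', w = u ++ .plus f :: u' ∧ run (stackStep G false) u s = some (G.r f, []) ∧
        stackStep G b (.plus f) (G.r f, []) = some (G.s f, []) ∧
        run (stackStep G b) u' (G.s f, []) = some t := by
  induction w generalizing s with
  | nil => exact Or.inl h
  | cons a w ih =>
    simp only [run, Option.bind_eq_some_iff] at h
    obtain ⟨x, hx, h⟩ := h
    by_cases hstep : stackStep G false a s = some x
    · rcases ih h with h1 | ⟨u, f, u', rfl, h1, h2, h3⟩
      · left
        rw [run, hstep]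
        exact h1
      · refine Or.inr ⟨a :: u, f, u', rfl, ?_, h2, h3⟩
        rw [run, hstep]
        exact h1
    · right
      obtain ⟨v, σ⟩ := s
      rcases a with f | f
      · exact absurd hx hstep
      · cases σ with
        | cons e σ => exact absurd hx hstep
        | nil =>
          have hx' := hx
          simp only [stackStep, Option.ite_none_right_eq_some, Option.some.injEq] at hx'
          obtain ⟨⟨-, rfl⟩, rfl⟩ := hx'
          exact ⟨[], f, w, rfl, rfl, hx, h⟩

/-- A run from the empty stack is a run to an empty stack, followed by a strict run. -/
theorem exists_append_of_run {b : Bool} {w : List (Letter E)} {v : V} {t : V × List E}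
    (h : run (stackStep G b) w (v, []) = some t) : ∃ u u' y, w = u ++ u' ∧
      run (stackStep G b) u (v, []) = some (y, []) ∧
      run (stackStep G false) u' (y, []) = some t := by
  induction w using List.reverseRecOn generalizing t with
  | nil => exact ⟨[], [], v, rfl, rfl, h⟩
  | append_singleton w a ih =>
    have h' := h
    rw [run_append, Option.bind_eq_some_iff] at h
    obtain ⟨s, hs, h⟩ := h
    simp only [run, Option.bind_eq_some_iff, Option.some.injEq, exists_eq_right] at h
    obtain ⟨u, u', y, rfl, h1, h2⟩ := ih hs
    by_cases hstep : stackStep G false a s = some t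
    · refine ⟨u, u' ++ [a], y, by simp, h1, ?_⟩
      rw [run_append, h2]
      simp [run, hstep]
    · obtain ⟨x, σ⟩ := s
      rcases a with f | f
      · exact absurd h hstep
      · cases σ with
        | cons e σ => exact absurd h hstep
        | nil =>
          simp only [stackStep, Option.ite_none_right_eq_some, Option.some.injEq] at h
          obtain ⟨-, rfl⟩ := h
          exact ⟨_, [], G.s f, by simp, h', rfl⟩

theorem eq_vertex_of_run {b b' : Bool} {w : List (Letter E)} (hw : w ≠ []) {s s' t t' : V × List E}
    (h : run (stackStep G b) w s = some t) (h' : run (stackStep G b') w s' = some t') :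
    s.1 = s'.1 := by
  cases w with
  | nil => exact absurd rfl hw
  | cons a w =>
    simp only [run, Option.bind_eq_some_iff] at h h'
    obtain ⟨x, hx, -⟩ := h
    obtain ⟨x', hx', -⟩ := h'
    rw [eq_source_of_stackStep G hx, eq_source_of_stackStep G hx']

/-- If the run from `σ` is not strict, it pops the empty stack at some moment. By `run_append_stack`
the run from `[]` is then in the same state, so both runs coincide afterwards and end with an empty
stack. -/
theorem eq_nil_or_length_eq_of_run {b : Bool} {u : List (Letter E)} {v v' x x' : V} {σ ρ : List E}
    (h : run (stackStep G b) u (v, []) = some (v', []))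
    (h' : run (stackStep G b) u (x, σ) = some (x', ρ)) :
    ρ = [] ∨ (σ.length : ℤ) + net u = ρ.length := by
  rcases run_false_or_exists_pop G h' with h1 | ⟨u₁, f, u₂, rfl, h0, h2, h3⟩
  · exact Or.inr (length_add_net_of_run_false G h1)
  · left
    have h1 := run_of_run_false G (b := b) h0
    obtain rfl : v = x := eq_vertex_of_run G (by simp) h h'
    rw [run_append, Option.bind_eq_some_iff] at h
    obtain ⟨⟨y, α⟩, hy, h⟩ := h
    obtain ⟨rfl, τ', hτ⟩ := run_append_stack G (τ := σ) hy h1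
    obtain rfl : α = [] := (List.append_eq_nil_iff.1 hτ.symm).1
    rw [run, h2, Option.bind_some, h3] at h
    simp only [Option.some.injEq, Prod.mk.injEq] at h
    exact h.2

/-- The second loop reads `u` from some stack `τ` down to the empty one. From the shorter stack
`[]`, `u` leaves an initial part of that result, which is empty. -/
theorem isCircular_stackStep (b : Bool) (v : V) : IsCircular (stackStep G b) (v, []) := by
  intro u w huw hwu
  rcases eq_or_ne u [] with rfl | hu
  · rfl
  · simp only [returns, Set.mem_ofPred_eq, run_append, Option.bind_eq_some_iff] at huw hwu
    obtain ⟨⟨y, σ⟩, h1, h2⟩ := huw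
    obtain ⟨⟨y', τ⟩, h3, h4⟩ := hwu
    obtain rfl : v = y' := eq_vertex_of_run G hu h1 h4
    obtain ⟨rfl, τ', hτ⟩ := run_append_stack G (τ := τ) h1 h4
    obtain rfl : σ = [] := (List.append_eq_nil_iff.1 hτ.symm).1
    exact h1

/-- The stack is a path from `v₀` to the current vertex. -/
def IsPathFrom (v₀ : V) : V → List E → Prop
  | v, [] => v = v₀
  | v, e :: σ => v = G.r e ∧ IsPathFrom v₀ (G.s e) σ

theorem isPathFrom_of_run_false {v₀ : V} {w : List (Letter E)} {s t : V × List E}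
    (h : run (stackStep G false) w s = some t) (hs : IsPathFrom G v₀ s.1 s.2) :
    IsPathFrom G v₀ t.1 t.2 := by
  induction w generalizing s with
  | nil =>
    simp only [run, Option.some.injEq] at h
    rwa [← h]
  | cons a w ih =>
    simp only [run, Option.bind_eq_some_iff] at h
    obtain ⟨u, hu, h⟩ := h
    refine ih h ?_
    obtain ⟨v, σ⟩ := s
    rcases a with f | f
    · simp only [stackStep, Option.ite_none_right_eq_some, Option.some.injEq] at hu
      obtain ⟨rfl, rfl⟩ := hu
      exact ⟨rfl, hs⟩
    · cases σ with
      | nil => simp [stackStep] at hu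
      | cons e σ =>
        simp only [stackStep, Option.ite_none_right_eq_some, Option.some.injEq] at hu
        obtain ⟨⟨rfl, -⟩, rfl⟩ := hu
        exact hs.2

theorem eq_of_run_false_nil {w : List (Letter E)} {v y : V}
    (h : run (stackStep G false) w (v, []) = some (y, [])) : y = v :=
  isPathFrom_of_run_false G (v₀ := v) h rfl

/-! ### Membership in the shift -/

theorem mem_markovDyckShift_iff_run (x : ℤ → Letter E) : x ∈ (markovDyckShift G).carrier ↔
    ∀ i n, ∃ s t, run (stackStep G false) (listAt x i n) s = some t := by
  have : Nonempty V := ⟨(x 0).source G⟩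
  rw [mem_markovDyckShift_iff]
  refine forall₂_congr fun i n => ⟨fun h => ?_, fun ⟨s, t, h⟩ => prod_ne_zeroElt_of_run G h⟩
  obtain ⟨v, t, h⟩ := (prod_ne_zeroElt_iff G _).1 h
  obtain ⟨τ, t', h'⟩ := exists_run_false_of_run G h
  exact ⟨_, t', h'⟩

theorem exists_run_of_mem {x : ℤ → Letter E} (hx : x ∈ (markovDyckShift G).carrier) (i : ℤ)
    (n : ℕ) : ∃ v t, run (stackStep G true) (listAt x i n) (v, []) = some t := by
  have : Nonempty V := ⟨(x 0).source G⟩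
  exact (prod_ne_zeroElt_iff G _).1 ((mem_markovDyckShift_iff G x).1 hx i n)

theorem listAt_mul_mem_returns {A S : Type*} {step : A → S → Option S} {s : S} {x : ℤ → A} {n : ℕ}
    (hx : ∀ i, x (i + n) = x i) {i : ℤ} (h : listAt x i n ∈ returns step s) (k : ℕ) :
    listAt x i (k * n) ∈ returns step s := by
  induction k with
  | zero => simp [nil_mem_returns]
  | succ k ih =>
    rw [Nat.succ_mul, add_comm, listAt_add, listAt_of_periodic hx]
    exact (append_mem_returns h).2 ih

theorem listAt_sub_mul {A : Type*} {x : ℤ → A} {n : ℕ}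
    (hx : ∀ i, x (i + n) = x i) (i : ℤ) (k : ℤ) (m : ℕ) :
    listAt x (i - k * n) m = listAt x i m := by
  have hper : Function.Periodic (fun i : ℤ => listAt x i m) (n : ℤ) :=
    fun i => listAt_of_periodic hx i m
  simpa using hper.sub_int_mul_eq (x := i) k

/-- Every finite word of `x` lies in a power of the loop. The power can be read, so its product is
non-zero, and so are the products of its factors. -/
theorem mem_markovDyckShift_of_returns {b : Bool} {s : V × List E} {x : ℤ → Letter E} {n : ℕ}
    [NeZero n] (hx : ∀ i, x (i + n) = x i) {i : ℤ}
    (h : listAt x i n ∈ returns (stackStep G b) s) : x ∈ (markovDyckShift G).carrier := by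
  rw [mem_markovDyckShift_iff]
  intro j m h0
  have hn : (1 : ℤ) ≤ n := by exact_mod_cast NeZero.one_le
  have h1 : i - (i - j).toNat * n ≤ j := by nlinarith [Int.self_le_toNat (i - j)]
  obtain ⟨p, hp⟩ := Int.eq_ofNat_of_zero_le (sub_nonneg.2 h1)
  have h2 : p + m ≤ (p + m) * n := Nat.le_mul_of_pos_right _ (NeZero.pos n)
  obtain ⟨q, hq⟩ := Nat.exists_eq_add_of_le h2
  have h3 := listAt_mul_mem_returns hx h (p + m)
  rw [← listAt_sub_mul hx i ((i - j).toNat : ℤ), hq, listAt_add, listAt_add] at h3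
  have hpj : i - ((i - j).toNat : ℤ) * n + p = j := by
    have : j - (i - ((i - j).toNat : ℤ) * n) = p := hp
    linarith
  rw [hpj] at h3
  obtain ⟨τ, t', h'⟩ := exists_run_false_of_run G (v := s.1) (σ := s.2) h3
  refine prod_ne_zeroElt_of_run G h' ?_
  rw [List.map_append, List.map_append, List.prod_append, List.prod_append, h0, mul_zeroElt,
    zeroElt_mul]

/-- The word of length `n + 1` can also be read. Its last letter equals its first one, and a letter
determines the vertex at which it is read. -/
theorem eq_of_run_listAt {x : ℤ → Letter E} (hX : x ∈ (markovDyckShift G).carrier) {n : ℕ}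
    [NeZero n] (hx : ∀ i, x (i + n) = x i) {i : ℤ} {v v' : V}
    (h : run (stackStep G true) (listAt x i n) (v, []) = some (v', [])) : v' = v := by
  obtain ⟨m, rfl⟩ := Nat.exists_eq_succ_of_ne_zero (NeZero.ne n)
  obtain ⟨y, t, ht⟩ := exists_run_of_mem G hX i (m + 1 + 1)
  rw [listAt_add, run_append, Option.bind_eq_some_iff] at ht
  obtain ⟨t', h1, h2⟩ := ht
  obtain rfl : v = y := eq_vertex_of_run G (by simp [listAt_succ]) h h1
  obtain rfl := Option.some.inj (h.symm.trans h1)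
  rw [listAt_succ, hx, run, Option.bind_eq_some_iff] at h2
  obtain ⟨_, h2, -⟩ := h2
  rw [listAt_succ, run, Option.bind_eq_some_iff] at h
  obtain ⟨_, h3, -⟩ := h
  exact (eq_source_of_stackStep G h2).trans (eq_source_of_stackStep G h3).symm

/-- A periodic point that pushes at most as much as it pops returns to an empty stack. -/
theorem exists_mem_returns_of_net_nonpos {x : ℤ → Letter E}
    (hX : x ∈ (markovDyckShift G).carrier) {n : ℕ} [NeZero n] (hx : ∀ i, x (i + n) = x i)
    (hnet : net (listAt x 0 n) ≤ 0) :
    ∃ i v, listAt x i n ∈ returns (stackStep G true) (v, []) := by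
  suffices ∃ i v v', run (stackStep G true) (listAt x i n) (v, []) = some (v', []) by
    obtain ⟨i, v, v', h⟩ := this
    obtain rfl := eq_of_run_listAt G hX hx h
    exact ⟨i, v', h⟩
  obtain ⟨v, t, h⟩ := exists_run_of_mem G hX 0 n
  obtain ⟨w₁, w₂, y, hw, h1, h2⟩ := exists_append_of_run G h
  rcases eq_or_ne w₂ [] with rfl | hw₂
  · exact ⟨0, v, y, by rw [hw, List.append_nil]; exact h1⟩
  -- Read first, `w₂` builds a stack of height `net w₂`. Then `w₁` either empties it or runs with
  -- exact height count; the final height would be the total net push, which is at most zero.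
  have hrot : listAt x w₁.length n = w₂ ++ w₁ := by
    simpa using listAt_rotate hx hw
  obtain ⟨v₀, ⟨v₂, ρ⟩, h3⟩ := exists_run_of_mem G hX w₁.length n
  refine ⟨w₁.length, v₀, v₂, ?_⟩
  suffices ρ = [] by rw [h3, this]
  rw [hrot, run_append, Option.bind_eq_some_iff] at h3
  obtain ⟨⟨v₁, σ⟩, h4, h5⟩ := h3
  obtain rfl : y = v₀ := eq_vertex_of_run G hw₂ h2 h4
  have h6 := length_add_net_of_run_false G h2
  obtain rfl := Option.some.inj ((run_of_run_false G h2).symm.trans h4)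
  have hσ : (σ.length : ℤ) = net w₂ := by simpa using h6.symm
  rcases eq_nil_or_length_eq_of_run G h1 h5 with h9 | h9
  · exact h9
  · have : net w₁ + net w₂ ≤ 0 := by rwa [hw, net_append] at hnet
    have : (ρ.length : ℤ) ≤ 0 := by linarith
    exact List.length_eq_zero_iff.1 (by omega)

/-! ### Counting periodic points -/

/-- The points of period `n` of the Markov-Dyck shift whose net push over a period lies in `I`. -/
def netPoints (n : ℕ) (I : Set ℤ) : Set (ℤ → Letter E) :=
  {x | x ∈ (markovDyckShift G).carrier ∧ (∀ i, x (i + n) = x i) ∧ net (listAt x 0 n) ∈ I}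

theorem netPoints_Iic (n : ℕ) [NeZero n] :
    netPoints G n (Set.Iic 0) = ⋃ v, cyclicPoints (stackStep G true) (v, []) n := by
  ext x
  simp only [netPoints, cyclicPoints, Set.mem_ofPred_eq, Set.mem_iUnion, Set.mem_Iic]
  constructor
  · rintro ⟨hX, hx, hnet⟩
    obtain ⟨i, v, h⟩ := exists_mem_returns_of_net_nonpos G hX hx hnet
    exact ⟨v, hx, i, h⟩
  · rintro ⟨v, hx, i, h⟩
    refine ⟨mem_markovDyckShift_of_returns G hx h, hx, ?_⟩
    simpa [net_listAt hx] using (length_add_net_le_of_run G h).1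

theorem netPoints_zero (n : ℕ) [NeZero n] :
    netPoints G n {0} = ⋃ v, cyclicPoints (stackStep G false) (v, []) n := by
  ext x
  simp only [netPoints, cyclicPoints, Set.mem_ofPred_eq, Set.mem_iUnion, Set.mem_singleton_iff]
  constructor
  · rintro ⟨hX, hx, hnet⟩
    obtain ⟨i, v, h⟩ := exists_mem_returns_of_net_nonpos G hX hx hnet.le
    exact ⟨v, hx, i, (length_add_net_le_of_run G h).2 (by simp [net_listAt hx, hnet])⟩
  · rintro ⟨v, hx, i, h⟩
    refine ⟨mem_markovDyckShift_of_returns G hx h, hx, ?_⟩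
    simpa [net_listAt hx] using length_add_net_of_run_false G h

/-- In a common point, compare the runs on the part from the start `j` of the strict loop to the
start of the other one. By stack monotonicity the strict run arrives there at `v` with an empty
stack. A strict run between empty stacks does not change the vertex, so `v = v'`. -/
theorem disjoint_cyclicPoints {b : Bool} {v v' : V} (h : v ≠ v') (n : ℕ) [NeZero n] :
    Disjoint (cyclicPoints (stackStep G b) (v, []) n)
      (cyclicPoints (stackStep G false) (v', []) n) := by
  rw [Set.disjoint_left]
  rintro x ⟨hx, i, hi⟩ ⟨-, j, hj⟩
  refine h ?_
  obtain ⟨p, hp, hpn⟩ : ∃ p : ℕ, listAt x (j + p) n ∈ returns (stackStep G b) (v, []) ∧ p < n := by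
    have h1 := Int.emod_lt_of_pos (i - j) (b := n) (by exact_mod_cast NeZero.pos n)
    have h2 := Int.emod_nonneg (i - j) (b := n) (by exact_mod_cast NeZero.ne n)
    refine ⟨((i - j) % n).toNat, ?_, by omega⟩
    rw [Int.toNat_of_nonneg h2, Int.emod_def, mul_comm, ← add_sub_assoc, add_sub_cancel,
      listAt_sub_mul hx]
    exact hi
  obtain ⟨q, rfl⟩ := Nat.exists_eq_add_of_le hpn.le
  have h1 : listAt x (j + p) (p + q) = listAt x (j + p) q ++ listAt x j p := by
    rw [add_comm p q, listAt_add, ← listAt_of_periodic hx j]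
    congr 2
    push_cast
    ring
  have hu := listAt_add x j p q
  rw [h1] at hp
  rw [hu] at hj
  have hq : listAt x (j + p) q ≠ [] := by
    intro h0
    have := congrArg List.length h0
    simp only [length_listAt, List.length_nil] at this
    omega
  simp only [returns, Set.mem_ofPred_eq, run_append, Option.bind_eq_some_iff] at hp hj
  obtain ⟨⟨y, τ⟩, h2, h3⟩ := hp
  obtain ⟨⟨y', σ⟩, h4, h5⟩ := hj
  rcases eq_or_ne (listAt x j p) [] with h0 | h0
  · rw [h0] at h4
    obtain ⟨rfl, rfl⟩ := Prod.mk.inj (Option.some.inj h4)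
    exact eq_vertex_of_run G hq h2 h5
  · obtain rfl : y = v' := eq_vertex_of_run G h0 h3 h4
    obtain ⟨rfl, τ', hτ⟩ := run_append_stack G (τ := τ) h4 h3
    obtain rfl : σ = [] := (List.append_eq_nil_iff.1 hτ.symm).1
    exact eq_of_run_false_nil G h4

theorem reversal_mem {x : ℤ → Letter E} (hX : x ∈ (markovDyckShift G).carrier) :
    reversal x ∈ (markovDyckShift G).carrier := by
  rw [mem_markovDyckShift_iff_run] at hX ⊢
  intro i n
  obtain ⟨s, t, h⟩ := hX (-i - n + 1) n
  refine ⟨t, s, ?_⟩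
  rw [listAt_reversal]
  exact (run_false_iff_reverse G _ _ _).1 h

theorem reversal_mem_netPoints {x : ℤ → Letter E} {n : ℕ} {I : Set ℤ}
    (hx : x ∈ netPoints G n I) : reversal x ∈ netPoints G n (Neg.neg ⁻¹' I) := by
  obtain ⟨hX, hper, hI⟩ := hx
  refine ⟨reversal_mem G hX, fun i => ?_, ?_⟩
  · simp only [reversal]
    rw [← hper (-(i + n))]
    congr 2
    ring
  · rw [Set.mem_preimage, listAt_reversal, net_reverse_map_flip, neg_neg, net_listAt hper]
    exact hI

theorem ncard_netPoints_Ici (n : ℕ) :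
    (netPoints G n (Set.Ici 0)).ncard = (netPoints G n (Set.Iic 0)).ncard := by
  have hinj : Function.Injective (reversal : (ℤ → Letter E) → _) :=
    Function.LeftInverse.injective reversal_reversal
  rw [← Set.ncard_image_of_injective _ hinj]
  congr 1
  have h1 : Neg.neg ⁻¹' (Set.Ici (0 : ℤ)) = Set.Iic 0 := by ext; simp
  have h2 : Neg.neg ⁻¹' (Set.Iic (0 : ℤ)) = Set.Ici 0 := by ext; simp
  ext x
  constructor
  · rintro ⟨y, hy, rfl⟩
    exact h1 ▸ reversal_mem_netPoints G hy
  · intro hx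
    exact ⟨reversal x, h2 ▸ reversal_mem_netPoints G hx, reversal_reversal x⟩

theorem isPeriodicPt_shift_iff {A : Type*} (x : ℤ → A) (n : ℕ) :
    Function.IsPeriodicPt (shift (1 : ℤ)) n x ↔ ∀ i, x (i + n) = x i := by
  have h : ∀ (n : ℕ) (i : ℤ), ((shift (1 : ℤ))^[n] x) i = x (i + n) := by
    intro n
    induction n with
    | zero => simp
    | succ n ih =>
      intro i
      rw [Function.iterate_succ_apply']
      change ((shift (1 : ℤ))^[n] x) (1 + i) = _
      rw [ih]
      congr 1
      push_cast
      ring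
  rw [Function.IsPeriodicPt, Function.IsFixedPt, funext_iff]
  simp only [h]

theorem periodicCount_add [Finite (Letter E)] (n : ℕ) [NeZero n] :
    periodicCount (markovDyckShift G) n + (netPoints G n {0}).ncard =
      2 * (netPoints G n (Set.Iic 0)).ncard := by
  have hfin : ∀ I, (netPoints G n I).Finite := fun I =>
    (finite_periodic (Letter E) n).subset fun x hx => hx.2.1
  have hunion : {x ∈ (markovDyckShift G).carrier | Function.IsPeriodicPt (shift (1 : ℤ)) n x} =
      netPoints G n (Set.Iic 0) ∪ netPoints G n (Set.Ici 0) := by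
    ext x
    simp only [Set.mem_ofPred_eq, netPoints, Set.mem_union, isPeriodicPt_shift_iff, Set.mem_Iic,
      Set.mem_Ici]
    have := le_total (net (listAt x 0 n)) 0
    tauto
  have hinter : netPoints G n {0} = netPoints G n (Set.Iic 0) ∩ netPoints G n (Set.Ici 0) := by
    ext x
    simp only [Set.mem_ofPred_eq, netPoints, Set.mem_inter_iff, Set.mem_Iic, Set.mem_Ici,
      Set.mem_singleton_iff, le_antisymm_iff]
    tauto
  rw [periodicCount, hunion, hinter, Set.ncard_union_add_ncard_inter _ _ (hfin _) (hfin _),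
    ncard_netPoints_Ici, two_mul]

/-! ### Admissible words -/

/-- A word read strictly from a sufficiently long stack, followed by its formal inverse, returns to
its initial state. The periodic repetition of this loop is a point of the shift that contains the
word. -/
theorem admissibleWords_eq [Nonempty V] (n : ℕ) [NeZero n] :
    admissibleWords (markovDyckShift G) n =
      {w | ∃ v t, run (stackStep G true) (List.ofFn w) (v, []) = some t} := by
  ext w
  constructor
  · rintro ⟨x, hx, i, rfl⟩
    exact exists_run_of_mem G hx i n
  · rintro ⟨v, t, h⟩
    obtain ⟨τ, t', h'⟩ := exists_run_false_of_run G h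
    set u := List.ofFn w with hu
    have hlen : (u ++ u.reverse.map Letter.flip).length = n + n := by simp [hu]
    have : NeZero (n + n) := ⟨by have := NeZero.ne n; omega⟩
    obtain ⟨⟨x, hx⟩, hxw⟩ := (periodicEquiv (Letter E) (n + n)).surjective
      fun k => (u ++ u.reverse.map Letter.flip).get (k.cast hlen.symm)
    have hlist : listAt x 0 (n + n) = u ++ u.reverse.map Letter.flip := by
      have h1 : wordAt x 0 (n + n) = _ := hxw
      rw [listAt, h1]
      refine List.ext_getElem (by rw [List.length_ofFn, hlen]) fun k h1 h2 => by simp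
    refine ⟨x, mem_markovDyckShift_of_returns G (b := false) (s := (v, [] ++ τ)) (i := 0) hx ?_, 0, ?_⟩
    · rw [hlist, returns, Set.mem_ofPred_eq, run_append, h', Option.bind_some]
      exact (run_false_iff_reverse G _ _ _).1 h'
    · rw [listAt_add] at hlist
      exact List.ofFn_injective (List.append_inj_left hlist (by simp))

end Points

/-! ### Dyck words and first-return codes -/

section Wrap

variable {E : Type*}

/-- The word `e⁻ u e⁺`. -/
def wrap (e : E) (u : List (Letter E)) : List (Letter E) := .minus e :: (u ++ [.plus e])

theorem wrap_injective (e : E) : Function.Injective (wrap e) := by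
  intro u u' h
  simpa [wrap] using h

theorem disjoint_wrap {e f : E} (h : e ≠ f) (L L' : Set (List (Letter E))) :
    Disjoint (wrap e '' L) (wrap f '' L') := by
  rw [Set.disjoint_left]
  rintro _ ⟨u, -, rfl⟩ ⟨u', -, h'⟩
  simp only [wrap, List.cons.injEq, Letter.minus.injEq] at h'
  exact h h'.1.symm

/-- The letters are two copies of the edges. -/
def letterEquiv (E : Type*) : E ⊕ E ≃ Letter E where
  toFun := Sum.elim .minus .plus
  invFun
    | .minus e => .inl e
    | .plus e => .inr e
  left_inv x := by cases x <;> rfl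
  right_inv x := by cases x <;> rfl

instance [Fintype E] : Fintype (Letter E) := Fintype.ofEquiv _ (letterEquiv E)

theorem sum_letter [Fintype E] (f : Letter E → ℝ) :
    ∑ a, f a = ∑ e, f (.minus e) + ∑ e, f (.plus e) := by
  rw [← (letterEquiv E).sum_comp, Fintype.sum_sum_type]
  rfl

end Wrap

/-! ### First-return decomposition of Dyck words -/

section Codes

variable {V E : Type*} [DecidableEq V] [DecidableEq E] (G : DirectedGraph V E)

/-- The Dyck words that start at the vertex `v`. -/
abbrev dyckWords (v : V) : Set (List (Letter E)) := returns (stackStep G false) (v, [])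

/-- An edge on the stack is popped by the first letter that reaches a lower stack. -/
theorem exists_pop_of_run {b : Bool} {w : List (Letter E)} {v : V} {τ σ : List E} {e : E}
    {t : V × List E} (h : run (stackStep G b) w (v, τ ++ e :: σ) = some t)
    (hlen : t.2.length ≤ σ.length) : ∃ u u', w = u ++ .plus e :: u' ∧
      run (stackStep G false) u (v, τ) = some (G.r e, []) ∧
      run (stackStep G b) u' (G.s e, σ) = some t := by
  induction w generalizing v τ with
  | nil =>
    obtain rfl := Option.some.inj h
    simp only [List.length_append, List.length_cons] at hlen
    omega
  | cons a w ih =>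
    simp only [run, Option.bind_eq_some_iff] at h
    obtain ⟨x, hx, h⟩ := h
    rcases a with f | f
    · simp only [stackStep, Option.ite_none_right_eq_some, Option.some.injEq] at hx
      obtain ⟨rfl, rfl⟩ := hx
      obtain ⟨u, u', rfl, h1, h2⟩ := ih (τ := f :: τ) h
      exact ⟨.minus f :: u, u', rfl, by simpa [run, stackStep] using h1, h2⟩
    · cases τ with
      | nil =>
        simp only [stackStep, List.nil_append, Option.ite_none_right_eq_some,
          Option.some.injEq] at hx
        obtain ⟨⟨rfl, rfl⟩, rfl⟩ := hx
        exact ⟨[], w, rfl, rfl, h⟩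
      | cons g τ =>
        simp only [stackStep, List.cons_append, Option.ite_none_right_eq_some,
          Option.some.injEq] at hx
        obtain ⟨⟨rfl, rfl⟩, rfl⟩ := hx
        obtain ⟨u, u', rfl, h1, h2⟩ := ih h
        exact ⟨.plus g :: u, u', rfl, by simpa [run, stackStep] using h1, h2⟩

theorem run_wrap {b : Bool} {e : E} {u : List (Letter E)} (hu : u ∈ dyckWords G (G.r e))
    (σ : List E) : run (stackStep G b) (wrap e u) (G.s e, σ) = some (G.s e, σ) := by
  have h := run_append_of_run_false G (b := b) hu (e :: σ)
  simp only [List.nil_append] at h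
  simp [wrap, run, stackStep, run_append, h]

/-- Up to the last letter the edge `e` stays at the bottom of the stack, so no proper non-empty
prefix empties it. -/
theorem wrap_mem_firstReturns {b : Bool} {e : E} {u : List (Letter E)}
    (hu : u ∈ dyckWords G (G.r e)) : wrap e u ∈ firstReturns (stackStep G b) (G.s e, []) := by
  refine ⟨run_wrap G hu [], by simp [wrap], fun p q hpq hp => ?_⟩
  rcases p with _ | ⟨a, p⟩
  · exact Or.inl rfl
  right
  simp only [wrap, List.cons_append, List.cons.injEq] at hpq
  obtain ⟨rfl, hpq⟩ := hpq
  have hp' : run (stackStep G b) p (G.r e, [e]) = some (G.s e, []) := by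
    simpa [returns, run, stackStep] using hp
  rcases List.append_eq_append_iff.1 hpq with ⟨t, rfl, ht⟩ | ⟨t, rfl, rfl⟩
  · rcases t with _ | ⟨c, t⟩
    · exfalso
      simp only [List.append_nil] at hp'
      have h1 := run_append_of_run_false G (b := b) hu [e]
      simp only [List.nil_append] at h1
      simp [h1] at hp'
    · simp only [List.cons_append, List.cons.injEq, List.nil_eq, List.append_eq_nil_iff] at ht
      exact ht.2.2
  · exfalso
    have h2 : run (stackStep G false) (p ++ t) (G.r e, []) = some (G.r e, []) := hu
    rw [run_append, Option.bind_eq_some_iff] at h2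
    obtain ⟨⟨y, α⟩, h2, -⟩ := h2
    have h3 := run_append_of_run_false G (b := b) h2 [e]
    rw [List.nil_append, hp'] at h3
    simp at h3

theorem exists_wrap_of_mem_firstReturns {b : Bool} {v : V} {e : E} {w : List (Letter E)}
    (hw : .minus e :: w ∈ firstReturns (stackStep G b) (v, [])) :
    v = G.s e ∧ ∃ u ∈ dyckWords G (G.r e), .minus e :: w = wrap e u := by
  have h := hw.1
  simp only [returns, Set.mem_ofPred_eq, run, Option.bind_eq_some_iff, stackStep,
    Option.ite_none_right_eq_some, Option.some.injEq] at h
  obtain ⟨x, ⟨rfl, rfl⟩, h⟩ := h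
  obtain ⟨u, u', rfl, h1, h2⟩ := exists_pop_of_run G (τ := []) h (by simp)
  refine ⟨rfl, u, h1, ?_⟩
  rcases hw.2.2 (wrap e u) u' (by simp [wrap]) (run_wrap G h1 []) with h3 | rfl
  · simp [wrap] at h3
  · rfl

theorem firstReturns_false (v : V) : firstReturns (stackStep G false) (v, []) =
    {w | ∃ e, v = G.s e ∧ w ∈ wrap e '' dyckWords G (G.r e)} := by
  ext w
  constructor
  · intro hw
    rcases w with _ | ⟨e | e, w⟩
    · exact absurd rfl hw.2.1
    · obtain ⟨hv, u, hu, h⟩ := exists_wrap_of_mem_firstReturns G hw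
      exact ⟨e, hv, u, hu, h.symm⟩
    · have := hw.1
      simp [returns, run, stackStep] at this
  · rintro ⟨e, rfl, u, hu, rfl⟩
    exact wrap_mem_firstReturns G hu

theorem hasSum_image {A F : Type*} [NormedField F] {L : Set (List A)} {f : List A → List A}
    (hf : Function.Injective f) {m : ℕ} (hlen : ∀ u, (f u).length = u.length + m) {z g : F}
    (hg : HasSum (fun u : L => z ^ (u : List A).length) g) :
    HasSum (fun w : f '' L => z ^ (w : List A).length) (z ^ m * g) := by
  rw [← (Equiv.Set.image f L hf).hasSum_iff]
  refine (hg.mul_left (z ^ m)).congr_fun fun u => ?_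
  simp [hlen, pow_add, mul_comm]

theorem hasSum_wrap {F : Type*} [NormedField F] {e : E} {z g : F}
    (hg : HasSum (fun u : dyckWords G (G.r e) => z ^ (u : List (Letter E)).length) g) :
    HasSum (fun w : (wrap e '' dyckWords G (G.r e) : Set (List (Letter E))) =>
      z ^ (w : List (Letter E)).length) (z ^ 2 * g) :=
  hasSum_image (wrap_injective e) (fun u => by simp [wrap]) hg

/-- The generating function of the words that empty a stack, if `g v` is the one of the Dyck
words at the vertex `v`. -/
noncomputable def stackWeight (r : ℝ) (g : V → ℝ) : V → List E → ℝ
  | v, [] => g v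
  | v, e :: σ => g v * r * stackWeight r g (G.s e) σ

/-- Any non-negative solution `g` of the algebraic system dominates the true series: `stackWeight`,
a product over the levels to be emptied, is superharmonic. In particular a solution at one real
point proves convergence there. -/
theorem summable_dyckWords [Fintype E] {r : ℝ} (hr : 0 ≤ r) {g : V → ℝ} (hg : ∀ v, 0 ≤ g v)
    (h : ∀ v, 1 + r ^ 2 * (∑ f, if v = G.s f then g (G.r f) else 0) * g v = g v) (v : V) :
    Summable (fun w : dyckWords G v => r ^ (w : List (Letter E)).length) ∧
      ∑' w : dyckWords G v, r ^ (w : List (Letter E)).length ≤ g v := by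
  have hpos : ∀ σ v, 0 ≤ stackWeight G r g v σ := by
    intro σ
    induction σ with
    | nil => exact hg
    | cons e σ ih => exact fun v => mul_nonneg (mul_nonneg (hg v) hr) (ih _)
  have hminus : ∀ v σ, ∑ e, (stackStep G false (.minus e) (v, σ)).elim 0
      (fun s => stackWeight G r g s.1 s.2) =
      (∑ f, if v = G.s f then g (G.r f) else 0) * (r * stackWeight G r g v σ) := by
    intro v σ
    rw [Finset.sum_mul]
    refine Finset.sum_congr rfl fun e _ => ?_
    simp only [stackStep]
    split_ifs with hv
    · simp [stackWeight, hv, mul_assoc]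
    · simp
  have hplus0 : ∀ v, ∑ e, (stackStep G false (.plus e) (v, [])).elim 0
      (fun s => stackWeight G r g s.1 s.2) = 0 := by
    simp [stackStep]
  -- Only an inequality, since a stack whose top edge does not end at `v` cannot be popped.
  have hplus : ∀ v e σ, ∑ f, (stackStep G false (.plus f) (v, e :: σ)).elim 0
      (fun s => stackWeight G r g s.1 s.2) ≤ stackWeight G r g (G.s e) σ := by
    intro v e σ
    rw [Finset.sum_eq_single e (fun f _ hf => by simp [stackStep, hf.symm]) (by simp)]
    simp only [stackStep]
    split_ifs
    · simp
    · simpa using hpos σ _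
  refine summable_returns (stackStep G false) (Ψ := fun s => stackWeight G r g s.1 s.2) (v, []) hr
    (fun s => hpos s.2 s.1) ?_ ?_
  · rw [sum_letter, hminus, hplus0]
    refine le_of_eq (Eq.trans ?_ (h v))
    simp only [stackWeight]
    ring
  · rintro ⟨v', σ⟩ -
    rw [sum_letter, hminus]
    cases σ with
    | nil =>
      rw [hplus0]
      have := h v'
      simp only [stackWeight]
      nlinarith
    | cons e σ =>
      have h1 := hplus v' e σ
      have h2 := h v'
      have h3 := hpos σ (G.s e)
      simp only [stackWeight]
      calc _ ≤ r * ((∑ f, if v' = G.s f then g (G.r f) else 0) *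
            (r * (g v' * r * stackWeight G r g (G.s e) σ)) + stackWeight G r g (G.s e) σ) := by
            gcongr
        _ = (1 + r ^ 2 * (∑ f, if v' = G.s f then g (G.r f) else 0) * g v') *
            (r * stackWeight G r g (G.s e) σ) := by ring
        _ = _ := by rw [h2]; ring

end Codes

/-! ### The Fibonacci graph -/

section Fibonacci

/-- The edges of the Fibonacci graph. -/
abbrev FibEdge : Type :=
  Σ u : Fin 2, Σ v : Fin 2, Fin ((!![1, 1; 1, 0] : Matrix (Fin 2) (Fin 2) ℕ) u v)

/-- The directed graph with adjacency matrix `[[1, 1], [1, 0]]`. -/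
abbrev fibGraph : DirectedGraph (Fin 2) FibEdge := graphOfMatrix !![1, 1; 1, 0]

/-- The loop at the vertex `0`. -/
def edge00 : FibEdge := ⟨0, 0, ⟨0, Nat.one_pos⟩⟩

/-- The edge from `0` to `1`. -/
def edge01 : FibEdge := ⟨0, 1, ⟨0, Nat.one_pos⟩⟩

/-- The edge from `1` to `0`. -/
def edge10 : FibEdge := ⟨1, 0, ⟨0, Nat.one_pos⟩⟩

@[simp] theorem s_edge00 : fibGraph.s edge00 = 0 := rfl
@[simp] theorem r_edge00 : fibGraph.r edge00 = 0 := rfl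
@[simp] theorem s_edge01 : fibGraph.s edge01 = 0 := rfl
@[simp] theorem r_edge01 : fibGraph.r edge01 = 1 := rfl
@[simp] theorem s_edge10 : fibGraph.s edge10 = 1 := rfl
@[simp] theorem r_edge10 : fibGraph.r edge10 = 0 := rfl

theorem fibEdge_cases (e : FibEdge) : e = edge00 ∨ e = edge01 ∨ e = edge10 := by
  obtain ⟨u, v, k, hk⟩ := e
  fin_cases u <;> fin_cases v <;> simp at hk <;> subst hk
  · exact Or.inl rfl
  · exact Or.inr (Or.inl rfl)
  · exact Or.inr (Or.inr rfl)

instance : Fintype FibEdge where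
  elems := {edge00, edge01, edge10}
  complete e := by simpa using fibEdge_cases e

theorem univ_fibEdge : (Finset.univ : Finset FibEdge) = {edge00, edge01, edge10} := rfl

theorem edge00_ne_edge01 : edge00 ≠ edge01 := by decide
theorem edge00_ne_edge10 : edge00 ≠ edge10 := by decide
theorem edge01_ne_edge10 : edge01 ≠ edge10 := by decide

theorem sum_fibEdge {M : Type*} [AddCommMonoid M] (f : FibEdge → M) :
    ∑ e, f e = f edge00 + f edge01 + f edge10 := by
  rw [univ_fibEdge, Finset.sum_insert (by simp [edge00_ne_edge01, edge00_ne_edge10]),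
    Finset.sum_pair edge01_ne_edge10, add_assoc]

theorem firstReturns_fib_zero : firstReturns (stackStep fibGraph false) (0, []) =
    wrap edge00 '' dyckWords fibGraph 0 ∪ wrap edge01 '' dyckWords fibGraph 1 := by
  rw [firstReturns_false]
  ext w
  simp only [Set.mem_ofPred_eq, Set.mem_union]
  constructor
  · rintro ⟨e, he, hw⟩
    rcases fibEdge_cases e with rfl | rfl | rfl
    · exact Or.inl hw
    · exact Or.inr hw
    · simp at he
  · rintro (h | h)
    · exact ⟨edge00, rfl, h⟩
    · exact ⟨edge01, rfl, h⟩

theorem firstReturns_fib_one : firstReturns (stackStep fibGraph false) (1, []) =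
    wrap edge10 '' dyckWords fibGraph 0 := by
  rw [firstReturns_false]
  ext w
  constructor
  · rintro ⟨e, he, hw⟩
    rcases fibEdge_cases e with rfl | rfl | rfl
    · simp at he
    · simp at he
    · exact hw
  · exact fun h => ⟨edge10, rfl, h⟩

/-- The word that pops the edge to `0`, returns to the empty stack, and pops the edge to `1`. -/
def excursion (u : List (Letter FibEdge)) : List (Letter FibEdge) :=
  .plus edge10 :: (u ++ [.plus edge01])

theorem excursion_injective : Function.Injective excursion := by
  intro u u' h
  simpa [excursion] using h

/-- Besides matched words, an unmatched pop may leave vertex `0` along `edge00`, which returns at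
once, or along `edge10` to vertex `1`. From there the only unmatched pop is that of `edge01`, back
to `0`, after a Dyck word at `1`. -/
theorem firstReturns_fib_true : firstReturns (stackStep fibGraph true) (0, []) =
    (wrap edge00 '' dyckWords fibGraph 0 ∪ wrap edge01 '' dyckWords fibGraph 1) ∪
      ({[.plus edge00]} ∪ excursion '' dyckWords fibGraph 1) := by
  have hpop : [.plus edge00] ∈ returns (stackStep fibGraph true) (0, []) := by
    simp [returns, run, stackStep]
  ext w
  constructor
  · intro hw
    rcases w with _ | ⟨e | e, w⟩
    · exact absurd rfl hw.2.1
    · left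
      obtain ⟨hv, u, hu, h⟩ := exists_wrap_of_mem_firstReturns fibGraph hw
      rw [h]
      rcases fibEdge_cases e with rfl | rfl | rfl
      · exact Or.inl ⟨u, hu, rfl⟩
      · exact Or.inr ⟨u, hu, rfl⟩
      · simp at hv
    · right
      rcases fibEdge_cases e with rfl | rfl | rfl
      · left
        rcases hw.2.2 [.plus edge00] w rfl hpop with h | rfl
        · simp at h
        · rfl
      · have := hw.1
        simp [returns, run, stackStep] at this
      · right
        have h := hw.1
        simp only [returns, run, stackStep, true_and, r_edge10, s_edge10, if_true,
          Option.bind_some, Set.mem_ofPred_eq] at h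
        -- A strict continuation would end at vertex `1`, so some pop is unmatched; the first one
        -- occurs at vertex `1`, hence is that of `edge01`.
        rcases run_false_or_exists_pop fibGraph h with h1 | ⟨u, f, u', rfl, h1, h2, h3⟩
        · exact absurd (eq_of_run_false_nil fibGraph h1) (by decide)
        · have hr := eq_of_run_false_nil fibGraph h1
          rcases fibEdge_cases f with rfl | rfl | rfl
          · simp at hr
          · refine ⟨u, h1, ?_⟩
            have h1' := run_of_run_false fibGraph (b := true) h1
            simp only [r_edge01] at h1'
            have hret : excursion u ∈ returns (stackStep fibGraph true) (0, []) := by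
              simp [excursion, returns, run, stackStep, run_append, h1']
            rcases hw.2.2 (excursion u) u' (by simp [excursion]) hret with h4 | rfl
            · simp [excursion] at h4
            · rfl
          · simp at hr
  · rintro ((⟨u, hu, rfl⟩ | ⟨u, hu, rfl⟩) | (rfl | ⟨u, hu, rfl⟩))
    · exact wrap_mem_firstReturns fibGraph (e := edge00) hu
    · exact wrap_mem_firstReturns fibGraph (e := edge01) hu
    · refine ⟨hpop, by simp, fun p q hpq _ => ?_⟩
      rcases p with _ | ⟨a, p⟩
      · exact Or.inl rfl
      · right
        simp only [List.cons_append, List.cons.injEq, List.nil_eq, List.append_eq_nil_iff] at hpq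
        exact hpq.2.2
    · have h1 := run_of_run_false fibGraph (b := true) hu
      refine ⟨by simp [excursion, returns, run, stackStep, run_append, h1], by simp [excursion],
        fun p q hpq hp => ?_⟩
      rcases p with _ | ⟨a, p⟩
      · exact Or.inl rfl
      right
      simp only [excursion, List.cons_append, List.cons.injEq] at hpq
      obtain ⟨rfl, hpq⟩ := hpq
      have hp' : run (stackStep fibGraph true) p (1, []) = some (0, []) := by
        simpa [returns, run, stackStep] using hp
      rcases List.append_eq_append_iff.1 hpq with ⟨t, rfl, ht⟩ | ⟨t, rfl, rfl⟩
      · rcases t with _ | ⟨c, t⟩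
        · exfalso
          rw [List.append_nil, h1] at hp'
          simp at hp'
        · simp only [List.cons_append, List.cons.injEq, List.nil_eq, List.append_eq_nil_iff] at ht
          exact ht.2.2
      · exfalso
        have h2 : run (stackStep fibGraph false) (p ++ t) (1, []) = some (1, []) := hu
        rw [run_append, Option.bind_eq_some_iff] at h2
        obtain ⟨⟨y, α⟩, h2, -⟩ := h2
        have h3 := run_of_run_false fibGraph (b := true) h2
        rw [hp'] at h3
        obtain ⟨rfl, rfl⟩ := Prod.mk.inj (Option.some.inj h3)
        exact absurd (eq_of_run_false_nil fibGraph h2) (by decide)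

section Sums

variable {F : Type*} [NormedField F] {z g₀ g₁ : F}

theorem hasSum_firstReturns_fib_one
    (h₀ : HasSum (fun u : dyckWords fibGraph 0 => z ^ (u : List (Letter FibEdge)).length) g₀) :
    HasSum (fun u : firstReturns (stackStep fibGraph false) (1, []) =>
      z ^ (u : List (Letter FibEdge)).length) (z ^ 2 * g₀) := by
  rw [firstReturns_fib_one]
  exact hasSum_wrap fibGraph (e := edge10) h₀

theorem hasSum_wrap_union
    (h₀ : HasSum (fun u : dyckWords fibGraph 0 => z ^ (u : List (Letter FibEdge)).length) g₀)
    (h₁ : HasSum (fun u : dyckWords fibGraph 1 => z ^ (u : List (Letter FibEdge)).length) g₁) :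
    HasSum (fun u : (wrap edge00 '' dyckWords fibGraph 0 ∪ wrap edge01 '' dyckWords fibGraph 1 :
      Set (List (Letter FibEdge))) => z ^ (u : List (Letter FibEdge)).length)
      (z ^ 2 * (g₀ + g₁)) := by
  rw [mul_add]
  exact (hasSum_wrap fibGraph (e := edge00) h₀).add_disjoint
    (f := fun u : List (Letter FibEdge) => z ^ u.length) (disjoint_wrap edge00_ne_edge01 _ _)
    (hasSum_wrap fibGraph (e := edge01) h₁)

theorem hasSum_firstReturns_fib_zero
    (h₀ : HasSum (fun u : dyckWords fibGraph 0 => z ^ (u : List (Letter FibEdge)).length) g₀)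
    (h₁ : HasSum (fun u : dyckWords fibGraph 1 => z ^ (u : List (Letter FibEdge)).length) g₁) :
    HasSum (fun u : firstReturns (stackStep fibGraph false) (0, []) =>
      z ^ (u : List (Letter FibEdge)).length) (z ^ 2 * (g₀ + g₁)) := by
  rw [firstReturns_fib_zero]
  exact hasSum_wrap_union h₀ h₁

theorem hasSum_firstReturns_fib_true
    (h₀ : HasSum (fun u : dyckWords fibGraph 0 => z ^ (u : List (Letter FibEdge)).length) g₀)
    (h₁ : HasSum (fun u : dyckWords fibGraph 1 => z ^ (u : List (Letter FibEdge)).length) g₁) :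
    HasSum (fun u : firstReturns (stackStep fibGraph true) (0, []) =>
      z ^ (u : List (Letter FibEdge)).length) (z ^ 2 * (g₀ + g₁) + (z + z ^ 2 * g₁)) := by
  rw [firstReturns_fib_true]
  have h2 : HasSum (fun u : ({[.plus edge00]} : Set (List (Letter FibEdge))) =>
      z ^ (u : List (Letter FibEdge)).length) z := by
    have := hasSum_unique fun u : ({[.plus edge00]} : Set (List (Letter FibEdge))) =>
      z ^ (u : List (Letter FibEdge)).length
    simpa using this
  have h3 : HasSum (fun u : (excursion '' dyckWords fibGraph 1 : Set (List (Letter FibEdge))) =>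
      z ^ (u : List (Letter FibEdge)).length) (z ^ 2 * g₁) :=
    hasSum_image excursion_injective (fun u => by simp [excursion]) h₁
  refine (hasSum_wrap_union h₀ h₁).add_disjoint
    (f := fun u : List (Letter FibEdge) => z ^ u.length) ?_ (h2.add_disjoint
    (f := fun u : List (Letter FibEdge) => z ^ u.length) ?_ h3)
  · rw [Set.disjoint_left]
    rintro _ (⟨u, -, rfl⟩ | ⟨u, -, rfl⟩) (h | ⟨u', -, h⟩) <;> simp [wrap, excursion] at h
  · rw [Set.disjoint_left]
    rintro _ rfl ⟨u, -, h⟩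
    simp [excursion] at h

end Sums

/-! ### Periodic points of the Fibonacci-Dyck shift -/

/-- A lax loop at `1` that is not strict pops `edge01` from the empty stack, hence visits vertex `0`
with an empty stack and is a rotation of a loop there. -/
theorem cyclicPoints_true_one_subset (n : ℕ) :
    cyclicPoints (stackStep fibGraph true) (1, []) n ⊆
      cyclicPoints (stackStep fibGraph true) (0, []) n ∪
        cyclicPoints (stackStep fibGraph false) (1, []) n := by
  rintro x ⟨hx, i, hi⟩
  rcases run_false_or_exists_pop fibGraph hi with h | ⟨u, f, u', hw, h1, h2, h3⟩
  · exact Or.inr ⟨hx, i, h⟩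
  · left
    have hr := eq_of_run_false_nil fibGraph h1
    have hf : f = edge01 := by
      rcases fibEdge_cases f with rfl | rfl | rfl
      · simp at hr
      · rfl
      · simp at hr
    subst hf
    have hrot := listAt_rotate hx (u := u ++ [.plus edge01]) (w := u') (by simpa using hw)
    refine ⟨hx, i + (u ++ [Letter.plus edge01]).length, ?_⟩
    rw [hrot]
    have h1' := run_of_run_false fibGraph (b := true) h1
    simp only [s_edge01, r_edge01] at h1' h2 h3
    simp [returns, run_append, run, h1', h2, h3]

theorem netPoints_fib (n : ℕ) [NeZero n] : netPoints fibGraph n (Set.Iic 0) =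
    cyclicPoints (stackStep fibGraph true) (0, []) n ∪
      cyclicPoints (stackStep fibGraph false) (1, []) n := by
  rw [netPoints_Iic]
  apply Set.Subset.antisymm
  · refine Set.iUnion_subset fun v => ?_
    fin_cases v
    · exact Set.subset_union_left
    · exact cyclicPoints_true_one_subset n
  · refine Set.union_subset (Set.subset_iUnion
      (fun v => cyclicPoints (stackStep fibGraph true) (v, []) n) 0) ?_
    refine Set.Subset.trans ?_ (Set.subset_iUnion
      (fun v => cyclicPoints (stackStep fibGraph true) (v, []) n) 1)
    rintro x ⟨hx, i, hi⟩
    exact ⟨hx, i, run_of_run_false fibGraph hi⟩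

theorem netPoints_fib_zero (n : ℕ) [NeZero n] : netPoints fibGraph n {0} =
    cyclicPoints (stackStep fibGraph false) (0, []) n ∪
      cyclicPoints (stackStep fibGraph false) (1, []) n := by
  rw [netPoints_zero]
  ext x
  simp [Set.mem_iUnion, Fin.exists_fin_two]

/-- The strict loops at `1` occur twice among the points of net push `≤ 0` and once among those of
net push `0`; one copy remains. -/
theorem periodicCount_fib (n : ℕ) [NeZero n] :
    periodicCount fibonacciDyckShift n +
        (cyclicPoints (stackStep fibGraph false) (0, []) n).ncard =
      2 * (cyclicPoints (stackStep fibGraph true) (0, []) n).ncard +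
        (cyclicPoints (stackStep fibGraph false) (1, []) n).ncard := by
  have hfin : ∀ (b : Bool) v,
      (cyclicPoints (stackStep fibGraph b) (v, []) n).Finite := fun b v =>
    (finite_periodic (Letter FibEdge) n).subset fun x hx => hx.1
  have h := periodicCount_add fibGraph n
  rw [netPoints_fib, netPoints_fib_zero,
    Set.ncard_union_eq (disjoint_cyclicPoints fibGraph (by decide) n) (hfin _ _) (hfin _ _),
    Set.ncard_union_eq (disjoint_cyclicPoints fibGraph (by decide) n) (hfin _ _) (hfin _ _)] at h
  change periodicCount (markovDyckShift fibGraph) n + _ = _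
  omega

end Fibonacci

/-! ### Generating functions of the Fibonacci-Dyck shift -/

section GeneratingFunctions

/-- The generating function of the Dyck words of the Fibonacci graph at the vertex `v`. -/
noncomputable def dyckSeries {F : Type*} [NormedField F] (v : Fin 2) (z : F) : F :=
  ∑' w : dyckWords fibGraph v, z ^ (w : List (Letter FibEdge)).length

theorem summable_fib {r g₀ g₁ : ℝ} (hr : 0 ≤ r) (hg₀ : 0 ≤ g₀) (hg₁ : 0 ≤ g₁)
    (h₀ : 1 + r ^ 2 * (g₀ + g₁) * g₀ = g₀) (h₁ : 1 + r ^ 2 * g₀ * g₁ = g₁) (v : Fin 2) :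
    Summable (fun w : dyckWords fibGraph v => r ^ (w : List (Letter FibEdge)).length) ∧
      dyckSeries v r ≤ ![g₀, g₁] v := by
  refine summable_dyckWords fibGraph hr (g := ![g₀, g₁]) ?_ ?_ v
  · intro v
    fin_cases v <;> simpa
  · intro v
    rw [sum_fibEdge]
    fin_cases v
    · simpa using h₀
    · simpa using h₁

theorem dyckSeries_mono {v : Fin 2} {r R : ℝ} (hr : 0 ≤ r) (hrR : r ≤ R)
    (hs : Summable fun w : dyckWords fibGraph v => R ^ (w : List (Letter FibEdge)).length) :
    Summable (fun w : dyckWords fibGraph v => r ^ (w : List (Letter FibEdge)).length) ∧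
      dyckSeries v r ≤ dyckSeries v R := by
  have hle : ∀ w : dyckWords fibGraph v, r ^ (w : List (Letter FibEdge)).length ≤
      R ^ (w : List (Letter FibEdge)).length := fun w => pow_le_pow_left₀ hr hrR _
  have hs' := Summable.of_nonneg_of_le (fun w => by positivity) hle hs
  exact ⟨hs', hs'.tsum_le_tsum hle hs⟩

theorem sq_radius : (2 / (3 * √3)) ^ 2 = (4 / 27 : ℝ) := by
  rw [div_pow, mul_pow, Real.sq_sqrt (by norm_num)]
  norm_num

theorem radius_pos : 0 < 2 / (3 * √3) := by positivity

theorem lt_radius : 3 / 8 < 2 / (3 * √3) := by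
  refine lt_of_pow_lt_pow_left₀ 2 radius_pos.le ?_
  rw [sq_radius]
  norm_num

/-- At the radius the cubic has the double root `ξ = 1/√3`, so `T = ξ/z = 3/2` and `T² = 9/4` solve
the system of `summable_fib`. -/
theorem summable_radius (v : Fin 2) :
    Summable (fun w : dyckWords fibGraph v =>
      (2 / (3 * √3)) ^ (w : List (Letter FibEdge)).length) ∧
      dyckSeries v (2 / (3 * √3)) ≤ ![9 / 4, 3 / 2] v :=
  summable_fib radius_pos.le (by norm_num) (by norm_num) (by rw [sq_radius]; norm_num)
    (by rw [sq_radius]; norm_num) v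

theorem dyckSeries_le_of_le_radius {r : ℝ} (hr : 0 ≤ r) (h : r ≤ 2 / (3 * √3)) (v : Fin 2) :
    Summable (fun w : dyckWords fibGraph v => r ^ (w : List (Letter FibEdge)).length) ∧
      dyckSeries v r ≤ ![9 / 4, 3 / 2] v :=
  have := dyckSeries_mono hr h (summable_radius v).1
  ⟨this.1, this.2.trans (summable_radius v).2⟩

/-- At `3/8` the root is `ξ = 1/2`, so `T = 4/3` and `T² = 16/9`. -/
theorem dyckSeries_le_of_le {r : ℝ} (hr : 0 ≤ r) (h : r ≤ 3 / 8) (v : Fin 2) :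
    dyckSeries v r ≤ ![16 / 9, 4 / 3] v := by
  have h1 := summable_fib (r := 3 / 8) (g₀ := 16 / 9) (g₁ := 4 / 3) (by norm_num) (by norm_num)
    (by norm_num) (by norm_num) (by norm_num) v
  exact (dyckSeries_mono hr h h1.1).2.trans h1.2

theorem dyckSeries_nonneg {r : ℝ} (hr : 0 ≤ r) (v : Fin 2) : 0 ≤ dyckSeries v r :=
  tsum_nonneg fun _ => by positivity

theorem hasSum_dyckSeries_real {r : ℝ} (hr : 0 ≤ r) (h : r ≤ 2 / (3 * √3)) (v : Fin 2) :
    HasSum (fun w : dyckWords fibGraph v => r ^ (w : List (Letter FibEdge)).length)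
      (dyckSeries v r) :=
  (dyckSeries_le_of_le_radius hr h v).1.hasSum

theorem hasSum_dyckSeries {z : ℂ} (hz : ‖z‖ ≤ 2 / (3 * √3)) (v : Fin 2) :
    HasSum (fun w : dyckWords fibGraph v => z ^ (w : List (Letter FibEdge)).length)
      (dyckSeries v z) := by
  refine (Summable.of_norm ?_).hasSum
  simpa only [norm_pow] using (hasSum_dyckSeries_real (norm_nonneg z) hz v).summable

theorem ofReal_dyckSeries (v : Fin 2) (r : ℝ) :
    ((dyckSeries v r : ℝ) : ℂ) = dyckSeries v (r : ℂ) := by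
  simp [dyckSeries, Complex.ofReal_tsum]

theorem code_bounds {r : ℝ} (hr : 0 ≤ r) (h : r ≤ 2 / (3 * √3)) :
    r ^ 2 * (dyckSeries 0 r + dyckSeries 1 r) < 1 ∧ r ^ 2 * dyckSeries 0 r < 1 := by
  have h0 := (dyckSeries_le_of_le_radius hr h 0).2
  have h1 := (dyckSeries_le_of_le_radius hr h 1).2
  simp only [Matrix.cons_val_zero, Matrix.cons_val_one] at h0 h1
  have h2 : r ^ 2 ≤ 4 / 27 := sq_radius ▸ pow_le_pow_left₀ hr h 2
  have h3 := dyckSeries_nonneg hr 0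
  have h4 := dyckSeries_nonneg hr 1
  constructor
  · calc _ ≤ 4 / 27 * (9 / 4 + 3 / 2 : ℝ) := by gcongr
      _ < 1 := by norm_num
  · calc _ ≤ 4 / 27 * (9 / 4 : ℝ) := by gcongr
      _ < 1 := by norm_num

theorem hasSum_returns_geometric {A S : Type*} {step : A → S → Option S} {s : S} {z c : ℂ} {C : ℝ}
    (hc : HasSum (fun u : firstReturns step s => z ^ (u : List A).length) c)
    (hn : HasSum (fun u : firstReturns step s => ‖z‖ ^ (u : List A).length) C) (hC : C < 1) :
    ‖c‖ ≤ C ∧ HasSum (fun w : returns step s => z ^ (w : List A).length) (1 - c)⁻¹ := by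
  have hcC : ‖c‖ ≤ C := by
    rw [← hc.tsum_eq]
    refine tsum_of_norm_bounded hn fun u => ?_
    rw [norm_pow]
  refine ⟨hcC, ?_⟩
  have hC0 : 0 ≤ C := (norm_nonneg c).trans hcC
  have := hasSum_returns step (φ := fun _ => (1 : ℂ)) rfl hc hn
    (by simpa using hasSum_geometric_of_norm_lt_one (hcC.trans_lt hC))
    (by simpa using summable_geometric_of_lt_one hC0 hC)
  simpa using this

theorem dyckSeries_zero_eq {z : ℂ} (hz : ‖z‖ ≤ 2 / (3 * √3)) :
    dyckSeries 0 z = (1 - z ^ 2 * (dyckSeries 0 z + dyckSeries 1 z))⁻¹ ∧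
      ‖z ^ 2 * (dyckSeries 0 z + dyckSeries 1 z)‖ < 1 := by
  have hr := norm_nonneg z
  have h := hasSum_returns_geometric
    (hasSum_firstReturns_fib_zero (hasSum_dyckSeries hz 0) (hasSum_dyckSeries hz 1))
    (hasSum_firstReturns_fib_zero (hasSum_dyckSeries_real hr hz 0) (hasSum_dyckSeries_real hr hz 1))
    (code_bounds hr hz).1
  exact ⟨h.2.tsum_eq, h.1.trans_lt (code_bounds hr hz).1⟩

theorem dyckSeries_one_eq {z : ℂ} (hz : ‖z‖ ≤ 2 / (3 * √3)) :
    dyckSeries 1 z = (1 - z ^ 2 * dyckSeries 0 z)⁻¹ ∧ ‖z ^ 2 * dyckSeries 0 z‖ < 1 := by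
  have hr := norm_nonneg z
  have h := hasSum_returns_geometric (hasSum_firstReturns_fib_one (hasSum_dyckSeries hz 0))
    (hasSum_firstReturns_fib_one (hasSum_dyckSeries_real hr hz 0)) (code_bounds hr hz).2
  exact ⟨h.2.tsum_eq, h.1.trans_lt (code_bounds hr hz).2⟩

theorem one_sub_ne_zero_of_norm_lt {c : ℂ} (h : ‖c‖ < 1) : 1 - c ≠ 0 := by
  intro h0
  rw [← sub_eq_zero.1 h0, norm_one] at h
  exact lt_irrefl _ h

theorem dyckSeries_relations {z : ℂ} (hz : ‖z‖ ≤ 2 / (3 * √3)) :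
    dyckSeries 0 z = dyckSeries 1 z ^ 2 ∧ dyckSeries 1 z = 1 + z ^ 2 * dyckSeries 1 z ^ 3 := by
  obtain ⟨h0, h0'⟩ := dyckSeries_zero_eq hz
  obtain ⟨h1, h1'⟩ := dyckSeries_one_eq hz
  have h0'' := one_sub_ne_zero_of_norm_lt h0'
  have h1'' := one_sub_ne_zero_of_norm_lt h1'
  replace h0 := (mul_eq_one_iff_eq_inv₀ h0'').2 h0
  replace h1 := (mul_eq_one_iff_eq_inv₀ h1'').2 h1
  rcases eq_or_ne z 0 with rfl | hz0
  · simp only [ne_eq, OfNat.ofNat_ne_zero, not_false_eq_true, zero_pow, zero_mul, sub_zero,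
      mul_one] at h0 h1
    rw [h0, h1]
    simp
  generalize dyckSeries 0 z = a at *
  generalize dyckSeries 1 z = b at *
  have hb : b ≠ 0 := left_ne_zero_of_mul_eq_one h1
  -- With `z²ab = b - 1`, the equation for `a` multiplied by `z²b²` becomes `(b - 1)(1 - z²b²) =
  -- z²b²`, which is the cubic for `b`.
  have hcube : b = 1 + z ^ 2 * b ^ 3 := by
    have hu : z ^ 2 * a * b = b - 1 := by linear_combination -h1
    have e1 : z ^ 2 * b ^ 2 * (a * (1 - z ^ 2 * (a + b))) = z ^ 2 * b ^ 2 := by rw [h0, mul_one]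
    have e2 : z ^ 2 * b ^ 2 * (a * (1 - z ^ 2 * (a + b))) =
        (z ^ 2 * a * b) * (b - z ^ 2 * a * b - z ^ 2 * b ^ 2) := by ring
    rw [e2, hu] at e1
    linear_combination e1
  refine ⟨?_, hcube⟩
  have : z ^ 2 * b * (a - b ^ 2) = 0 := by linear_combination -h1 + hcube
  rcases mul_eq_zero.1 this with h | h
  · exact absurd h (mul_ne_zero (pow_ne_zero 2 hz0) hb)
  · exact sub_eq_zero.1 h

/-- The root `z T(z)` of `ξ³ - ξ + z = 0`, where `T = 1 + z² T³`. -/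
noncomputable def xi (z : ℂ) : ℂ := z * dyckSeries 1 z

theorem xi_cubic {z : ℂ} (hz : ‖z‖ ≤ 2 / (3 * √3)) : xi z ^ 3 - xi z + z = 0 := by
  have h := (dyckSeries_relations hz).2
  unfold xi
  linear_combination -z * h

theorem xi_zero : xi 0 = 0 := zero_mul _

theorem quadratic_xi_ne_zero {z : ℂ} (hz : ‖z‖ < 3 / 8) : 2 * xi z ^ 2 + xi z - 1 ≠ 0 := by
  intro h
  have hc := xi_cubic (hz.trans lt_radius).le
  have hf : (2 * xi z - 1) * (xi z + 1) = 0 := by linear_combination h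
  rcases mul_eq_zero.1 hf with h1 | h1
  · have hx : xi z = 1 / 2 := by linear_combination h1 / 2
    have : z = 3 / 8 := by
      rw [hx] at hc
      linear_combination hc
    rw [this] at hz
    norm_num at hz
  · have hx : xi z = -1 := by linear_combination h1
    have : z = 0 := by
      rw [hx] at hc
      linear_combination hc
    rw [this, xi_zero] at hx
    norm_num at hx

/-- The bounds at `3/8` give `7/16 + r + 3/16`, which is below `1` exactly for `r < 3/8`. -/
theorem true_code_bound {r : ℝ} (hr : 0 ≤ r) (h : r < 3 / 8) :
    r ^ 2 * (dyckSeries 0 r + dyckSeries 1 r) + (r + r ^ 2 * dyckSeries 1 r) < 1 := by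
  have h0 := dyckSeries_le_of_le hr h.le 0
  have h1 := dyckSeries_le_of_le hr h.le 1
  simp only [Matrix.cons_val_zero, Matrix.cons_val_one] at h0 h1
  have h3 := dyckSeries_nonneg hr 0
  have h4 := dyckSeries_nonneg hr 1
  calc _ ≤ (3 / 8) ^ 2 * (16 / 9 + 4 / 3 : ℝ) + (r + (3 / 8) ^ 2 * (4 / 3)) := by gcongr
    _ < 1 := by linarith

theorem hasSum_zetaTerm {z : ℂ} (hz : ‖z‖ < 3 / 8) :
    ∃ c, ‖c‖ < 1 ∧ c = z ^ 2 * (dyckSeries 0 z + dyckSeries 1 z) + (z + z ^ 2 * dyckSeries 1 z) ∧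
      HasSum (fun n : ℕ => zetaTerm fibonacciDyckShift z (n + 1))
        (2 * -Complex.log (1 - c) + -Complex.log (1 - z ^ 2 * dyckSeries 0 z) -
          -Complex.log (1 - z ^ 2 * (dyckSeries 0 z + dyckSeries 1 z))) := by
  have hr := norm_nonneg z
  have hz' := (hz.trans lt_radius).le
  have c0 := hasSum_dyckSeries hz' 0
  have c1 := hasSum_dyckSeries hz' 1
  have r0 := hasSum_dyckSeries_real hr hz' 0
  have r1 := hasSum_dyckSeries_real hr hz' 1
  have b := code_bounds hr hz'
  have bt := true_code_bound hr hz
  have ct := hasSum_firstReturns_fib_true c0 c1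
  have rt := hasSum_firstReturns_fib_true r0 r1
  have hA := hasSum_cyclicPoints (isCircular_stackStep fibGraph true 0) rfl ct rt bt
    (hasSum_returns_geometric ct rt bt).1
  have e0 := hasSum_firstReturns_fib_zero c0 c1
  have f0 := hasSum_firstReturns_fib_zero r0 r1
  have hB0 := hasSum_cyclicPoints (isCircular_stackStep fibGraph false 0) rfl e0 f0 b.1
    (hasSum_returns_geometric e0 f0 b.1).1
  have e1 := hasSum_firstReturns_fib_one c0
  have f1 := hasSum_firstReturns_fib_one r0
  have hB1 := hasSum_cyclicPoints (isCircular_stackStep fibGraph false 1) rfl e1 f1 b.2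
    (hasSum_returns_geometric e1 f1 b.2).1
  refine ⟨_, (hasSum_returns_geometric ct rt bt).1.trans_lt bt, rfl, ?_⟩
  refine (((hA.mul_left 2).add hB1).sub hB0).congr_fun fun n => ?_
  have hp := congrArg (Nat.cast : ℕ → ℂ) (periodicCount_fib (n + 1))
  push_cast at hp
  have hp' := eq_sub_of_add_eq hp
  rw [zetaTerm, hp']
  push_cast
  ring

theorem exp_neg_log_one_sub {c : ℂ} (h : ‖c‖ < 1) :
    Complex.exp (-Complex.log (1 - c)) = (1 - c)⁻¹ := by
  rw [Complex.exp_neg, Complex.exp_log (one_sub_ne_zero_of_norm_lt h)]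

theorem zeta_fib {z : ℂ} (hz : ‖z‖ < 3 / 8) (hz0 : z ≠ 0) :
    zeta fibonacciDyckShift z = xi z / (z * (2 * xi z ^ 2 + xi z - 1) ^ 2) := by
  obtain ⟨c, hc, hceq, hsum⟩ := hasSum_zetaTerm hz
  have hz' := (hz.trans lt_radius).le
  obtain ⟨h0, h0'⟩ := dyckSeries_zero_eq hz'
  obtain ⟨h1, h1'⟩ := dyckSeries_one_eq hz'
  obtain ⟨hsq, hcube⟩ := dyckSeries_relations hz'
  have hq := quadratic_xi_ne_zero hz
  rw [zeta, hsum.tsum_eq, Complex.exp_sub, Complex.exp_add, two_mul, Complex.exp_add,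
    exp_neg_log_one_sub hc, exp_neg_log_one_sub h0', exp_neg_log_one_sub h1', ← h0, ← h1]
  have hb : dyckSeries 1 z ≠ 0 := h1 ▸ inv_ne_zero (one_sub_ne_zero_of_norm_lt h1')
  -- Expanding `T(1 - c)` gives `T - z²T³ - 2z²T² - zT`, and `T - z²T³ = 1`.
  have hkey : dyckSeries 1 z * (1 - c) = -(2 * xi z ^ 2 + xi z - 1) := by
    rw [hceq, hsq]
    unfold xi
    linear_combination hcube
  have h1c : 1 - c = -(2 * xi z ^ 2 + xi z - 1) / dyckSeries 1 z := by
    rw [← hkey, mul_div_cancel_left₀ _ hb]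
  rw [h1c, hsq, show xi z / (z * (2 * xi z ^ 2 + xi z - 1) ^ 2) =
    dyckSeries 1 z / (2 * xi z ^ 2 + xi z - 1) ^ 2 by
      rw [xi, mul_div_mul_left _ _ hz0]]
  field_simp

end GeneratingFunctions

/-! ### The entropy of the Fibonacci-Dyck shift -/

section Entropy

theorem tendsto_log_div_of_bounds {L : ℕ → ℝ} {l : ℝ} (hl : 0 < l)
    (hlow : ∀ n, 0 < n → l ^ n ≤ L n)
    (hup : ∀ μ, l < μ → ∃ B, ∀ n, 0 < n → L n ≤ B * μ ^ n) :
    Tendsto (fun n : ℕ => 1 / (n : ℝ) * Real.log (L n)) atTop (𝓝 (Real.log l)) := by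
  have hpos : ∀ n, 0 < n → 0 < L n := fun n hn => (pow_pos hl n).trans_le (hlow n hn)
  rw [tendsto_order]
  constructor
  · intro a ha
    filter_upwards [eventually_gt_atTop 0] with n hn
    refine ha.trans_le ?_
    have hn' : (0 : ℝ) < n := by exact_mod_cast hn
    rw [one_div, ← div_eq_inv_mul, le_div_iff₀ hn', mul_comm, ← Real.log_pow]
    exact Real.log_le_log (pow_pos hl n) (hlow n hn)
  · intro a ha
    obtain ⟨b, hb, hba⟩ := exists_between ha
    have hμ : l < Real.exp b := (Real.log_lt_iff_lt_exp hl).1 hb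
    obtain ⟨B, hB⟩ := hup _ hμ
    have hB0 : 0 < B := by
      have := (hpos 1 one_pos).trans_le (hB 1 one_pos)
      exact pos_of_mul_pos_left this (by positivity)
    have hlim : Tendsto (fun n : ℕ => Real.log B / (n : ℝ) + b) atTop (𝓝 (0 + b)) :=
      (tendsto_const_div_atTop_nhds_zero_nat _).add_const b
    rw [zero_add] at hlim
    filter_upwards [eventually_gt_atTop 0, hlim.eventually_lt_const hba] with n hn hlt
    refine lt_of_le_of_lt ?_ hlt
    have hn' : (0 : ℝ) < n := by exact_mod_cast hn
    have h1 := Real.log_le_log (hpos n hn) (hB n hn)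
    rw [Real.log_mul hB0.ne' (by positivity), Real.log_pow, Real.log_exp] at h1
    rw [one_div, ← div_eq_inv_mul, div_le_iff₀ hn', add_mul, div_mul_cancel₀ _ hn'.ne']
    linarith

/-- A subharmonic function bounded by `1` counts each run with weight at most `1`, so its growth
rate bounds the number of runs from below. -/
theorem pow_mul_le_sum_run {A S : Type*} [Fintype A] (step : A → S → Option S) {Φ : S → ℝ} {l : ℝ}
    (hl : 0 ≤ l) (h1 : ∀ s, Φ s ≤ 1) (h : ∀ s, l * Φ s ≤ ∑ a, (step a s).elim 0 Φ) (n : ℕ) (s : S) :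
    l ^ n * Φ s ≤ ∑ w : Fin n → A, (run step (List.ofFn w) s).elim 0 fun _ => 1 := by
  induction n generalizing s with
  | zero => simpa [run] using h1 s
  | succ n ih =>
    rw [sum_run_succ, pow_succ, mul_assoc]
    refine (mul_le_mul_of_nonneg_left (h s) (pow_nonneg hl n)).trans ?_
    rw [Finset.mul_sum]
    refine Finset.sum_le_sum fun a _ => ?_
    cases step a s with
    | none => simp
    | some t => exact ih t

theorem sum_step_fib (b : Bool) (v : Fin 2) (σ : List FibEdge) (Φ : Fin 2 × List FibEdge → ℝ) :
    ∑ a, (stackStep fibGraph b a (v, σ)).elim 0 Φ =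
      (if v = 0 then Φ (0, edge00 :: σ) + Φ (1, edge01 :: σ) else Φ (0, edge10 :: σ)) +
        ∑ e, (stackStep fibGraph b (.plus e) (v, σ)).elim 0 Φ := by
  rw [sum_letter, sum_fibEdge]
  congr 1
  fin_cases v <;> simp [stackStep]

theorem sum_pop_cons (b : Bool) (v : Fin 2) (e : FibEdge) (σ : List FibEdge)
    (Φ : Fin 2 × List FibEdge → ℝ) :
    ∑ f, (stackStep fibGraph b (.plus f) (v, e :: σ)).elim 0 Φ =
      if v = fibGraph.r e then Φ (fibGraph.s e, σ) else 0 := by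
  rw [Finset.sum_eq_single e (fun f _ hf => by simp [stackStep, hf.symm]) (by simp)]
  simp only [stackStep, true_and]
  split_ifs <;> rfl

theorem sum_pop_nil (v : Fin 2) (Φ : Fin 2 × List FibEdge → ℝ) :
    ∑ f, (stackStep fibGraph true (.plus f) (v, [])).elim 0 Φ =
      if v = 0 then Φ (0, []) + Φ (1, []) else Φ (0, []) := by
  rw [sum_fibEdge]
  fin_cases v <;> simp [stackStep]

/-- Weights of stacks for the lower bound of the entropy. -/
noncomputable def lowerWeight : Fin 2 → List FibEdge → ℝ
  | v, [] => if v = 0 then 1 else 2 / 3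
  | v, e :: σ =>
    if v = fibGraph.r e then (if e = edge10 then 1 / 2 else 2 / 3) * lowerWeight (fibGraph.s e) σ
    else 0

theorem lowerWeight_nonneg (σ : List FibEdge) (v : Fin 2) : 0 ≤ lowerWeight v σ := by
  induction σ generalizing v with
  | nil => unfold lowerWeight; split_ifs <;> norm_num
  | cons e σ ih =>
    have := ih (fibGraph.s e)
    unfold lowerWeight
    split_ifs <;> positivity

theorem lowerWeight_le_one (σ : List FibEdge) (v : Fin 2) : lowerWeight v σ ≤ 1 := by
  induction σ generalizing v with
  | nil => unfold lowerWeight; split_ifs <;> norm_num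
  | cons e σ ih =>
    have := ih (fibGraph.s e)
    have := lowerWeight_nonneg σ (fibGraph.s e)
    unfold lowerWeight
    split_ifs <;> linarith

/-- With `r = 3/8` and `g = (16/9, 4/3)`, the weight `Φ` used here satisfies `Φ (v, e :: σ) = g v *
r * Φ (s e, σ)` on stacks whose top edge ends at `v`, with `g v * r` equal to `2/3` or `1/2`. On
empty stacks it is `1` and `1/2`. It is an exact eigenfunction for `8/3` there; stacks with a wrong
top edge get weight zero. -/
theorem lower_bound_words (n : ℕ) :
    (8 / 3 : ℝ) ^ n ≤ ∑ w : Fin n → Letter FibEdge,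
      (run (stackStep fibGraph true) (List.ofFn w) (0, [])).elim 0 fun _ => 1 := by
  have h := pow_mul_le_sum_run (stackStep fibGraph true) (l := 8 / 3)
    (Φ := fun s => (if s.1 = 0 then 1 else 3 / 4) * lowerWeight s.1 s.2) (by norm_num) ?_ ?_ n
    (0, [])
  · simpa [lowerWeight] using h
  · rintro ⟨v, σ⟩
    have := lowerWeight_le_one σ v
    have := lowerWeight_nonneg σ v
    dsimp only
    split_ifs <;> linarith
  · rintro ⟨v, σ⟩
    rw [sum_step_fib]
    cases σ with
    | nil =>
      rw [sum_pop_nil]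
      fin_cases v <;> norm_num [lowerWeight, edge00_ne_edge10, edge01_ne_edge10]
    | cons e σ =>
      rw [sum_pop_cons]
      by_cases hv : v = fibGraph.r e
      · subst hv
        rcases fibEdge_cases e with rfl | rfl | rfl <;>
          simp [lowerWeight, edge00_ne_edge10, edge01_ne_edge10] <;> linarith
      · have h0 : lowerWeight v (e :: σ) = 0 := by simp [lowerWeight, hv]
        rw [h0, mul_zero, mul_zero, if_neg hv, add_zero]
        have h1 := lowerWeight_nonneg (edge00 :: e :: σ) 0
        have h2 := lowerWeight_nonneg (edge01 :: e :: σ) 1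
        have h3 := lowerWeight_nonneg (edge10 :: e :: σ) 0
        split_ifs <;> simp <;> linarith

/-- Weights of stacks for the upper bound of the entropy. -/
noncomputable def upperWeight (r : ℝ) (q B : Fin 2 → ℝ) : Fin 2 → List FibEdge → ℝ
  | v, [] => B v
  | v, e :: σ => q v + (if v = 0 then 16 / 9 else 4 / 3) * r * upperWeight r q B (fibGraph.s e) σ

/-- `9/16` and `3/4` are the inverses of `T²` and `T` at `3/8`. The reduced determinant `9/16 - r -
(4/3)r²` vanishes at `3/8`, so non-negative solutions exist below it. -/
theorem exists_linear_solution {r : ℝ} (hr : 0 ≤ r) (h : r < 3 / 8) {k₀ k₁ : ℝ} (hk₀ : 0 ≤ k₀)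
    (hk₁ : 0 ≤ k₁) : ∃ x₀ x₁ : ℝ, 0 ≤ x₀ ∧ 0 ≤ x₁ ∧ 9 / 16 * x₀ = k₀ + r * (x₀ + x₁) ∧
      3 / 4 * x₁ = k₁ + r * x₀ := by
  have hD : 0 < 9 / 16 - r - 4 / 3 * r ^ 2 := by nlinarith
  set x₀ := (k₀ + 4 / 3 * r * k₁) / (9 / 16 - r - 4 / 3 * r ^ 2) with hx
  have hx0 : 0 ≤ x₀ := by positivity
  have he : x₀ * (9 / 16 - r - 4 / 3 * r ^ 2) = k₀ + 4 / 3 * r * k₁ := div_mul_cancel₀ _ hD.ne'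
  refine ⟨x₀, 4 / 3 * (k₁ + r * x₀), hx0, by positivity, ?_, by ring⟩
  linear_combination he

/-- The two linear systems are the superharmonicity conditions of `upperWeight` with source `1`: `q`
for non-empty stacks and `B` for empty ones. Pushing contributes at most `7/16` or `1/4` of the
weight of the current stack since `r² ≤ 9/64`, which leaves the factors `9/16` and `3/4`. -/
theorem upper_bound_words {r : ℝ} (hr : 0 ≤ r) (h : r < 3 / 8) :
    ∃ B : Fin 2 → ℝ, ∀ n v, r ^ n * ∑ w : Fin n → Letter FibEdge,
      (run (stackStep fibGraph true) (List.ofFn w) (v, [])).elim 0 (fun _ => 1) ≤ B v := by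
  obtain ⟨q₀, q₁, hq₀, hq₁, hq, hq'⟩ := exists_linear_solution hr h zero_le_one zero_le_one
  obtain ⟨B₀, B₁, hB₀, hB₁, hB, hB'⟩ := exists_linear_solution hr h
    (k₀ := 1 + r * (q₀ + q₁)) (k₁ := 1 + r * q₀) (by positivity) (by positivity)
  have hr2 : r ^ 2 ≤ 9 / 64 := by nlinarith
  have hpos : ∀ σ v, 0 ≤ upperWeight r ![q₀, q₁] ![B₀, B₁] v σ := by
    intro σ
    induction σ with
    | nil => intro v; fin_cases v <;> simpa [upperWeight]
    | cons e σ ih =>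
      intro v
      have := ih (fibGraph.s e)
      unfold upperWeight
      fin_cases v <;> simp <;> positivity
  refine ⟨![B₀, B₁], fun n v => ?_⟩
  have key := sum_run_le_of_superharmonic (stackStep fibGraph true) (f := fun _ => 1) (r := r)
    (Ψ := fun s => upperWeight r ![q₀, q₁] ![B₀, B₁] s.1 s.2) hr (fun s => hpos s.2 s.1) ?_
    (n + 1) (v, [])
  · rw [Finset.sum_range_succ] at key
    refine le_trans ?_ key
    refine le_add_of_nonneg_left (Finset.sum_nonneg fun m _ => mul_nonneg (pow_nonneg hr m)
      (Finset.sum_nonneg fun w _ => ?_))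
    cases run (stackStep fibGraph true) (List.ofFn w) (v, []) <;> simp
  · rintro ⟨v, σ⟩
    rw [sum_step_fib]
    dsimp only
    cases σ with
    | nil =>
      rw [sum_pop_nil]
      fin_cases v
      · simp [upperWeight]
        nlinarith
      · simp [upperWeight]
        nlinarith
    | cons e σ =>
      rw [sum_pop_cons]
      have hY := hpos σ (fibGraph.s e)
      have hX := hpos (e :: σ) v
      have hpop : (if v = fibGraph.r e then
          upperWeight r ![q₀, q₁] ![B₀, B₁] (fibGraph.s e) σ else 0) ≤
          upperWeight r ![q₀, q₁] ![B₀, B₁] (fibGraph.s e) σ := by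
        split_ifs
        · exact le_rfl
        · exact hY
      have hdef : upperWeight r ![q₀, q₁] ![B₀, B₁] v (e :: σ) = ![q₀, q₁] v +
        (if v = 0 then 16 / 9 else 4 / 3) * r *
          upperWeight r ![q₀, q₁] ![B₀, B₁] (fibGraph.s e) σ := rfl
      have hpush : ∀ (f : FibEdge) (u : Fin 2), upperWeight r ![q₀, q₁] ![B₀, B₁] u (f :: e :: σ) =
          ![q₀, q₁] u + (if u = 0 then 16 / 9 else 4 / 3) * r *
          upperWeight r ![q₀, q₁] ![B₀, B₁] (fibGraph.s f) (e :: σ) := fun _ _ => rfl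
      rw [hpush, hpush, hpush]
      have hpop' := mul_le_mul_of_nonneg_left hpop hr
      generalize (if v = fibGraph.r e then
          upperWeight r ![q₀, q₁] ![B₀, B₁] (fibGraph.s e) σ else 0) = Z at *
      generalize upperWeight r ![q₀, q₁] ![B₀, B₁] (fibGraph.s e) σ = Y at *
      have hX2 := mul_le_mul_of_nonneg_right hr2 hX
      fin_cases v
      · simp only [Fin.zero_eta, s_edge00, s_edge01, if_true] at *
        generalize upperWeight r ![q₀, q₁] ![B₀, B₁] 0 (e :: σ) = X at *
        simp at *
        nlinarith
      · simp only [Fin.mk_one, s_edge10, if_true] at *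
        generalize upperWeight r ![q₀, q₁] ![B₀, B₁] 1 (e :: σ) = X at *
        simp at *
        nlinarith

theorem ncard_admissibleWords_bounds (n : ℕ) [NeZero n] :
    (∑ w : Fin n → Letter FibEdge,
      (run (stackStep fibGraph true) (List.ofFn w) (0, [])).elim (0 : ℝ) fun _ => 1) ≤
        ((admissibleWords fibonacciDyckShift n).ncard : ℝ) ∧
    ((admissibleWords fibonacciDyckShift n).ncard : ℝ) ≤
      (∑ w : Fin n → Letter FibEdge,
        (run (stackStep fibGraph true) (List.ofFn w) (0, [])).elim (0 : ℝ) fun _ => 1) +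
      ∑ w : Fin n → Letter FibEdge,
        (run (stackStep fibGraph true) (List.ofFn w) (1, [])).elim (0 : ℝ) fun _ => 1 := by
  classical
  have hcard : ((admissibleWords fibonacciDyckShift n).ncard : ℝ) =
      ∑ w : Fin n → Letter FibEdge, if ∃ v t, run (stackStep fibGraph true) (List.ofFn w) (v, []) =
        some t then (1 : ℝ) else 0 := by
    rw [show fibonacciDyckShift = markovDyckShift fibGraph from rfl, admissibleWords_eq,
      Finset.sum_boole, ← Set.ncard_coe_finset]
    congr 2
    ext w
    simp
  rw [hcard, ← Finset.sum_add_distrib]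
  constructor
  · refine Finset.sum_le_sum fun w _ => ?_
    cases h : run (stackStep fibGraph true) (List.ofFn w) (0, []) with
    | none => simp only [Option.elim_none]; split_ifs <;> norm_num
    | some t => rw [if_pos ⟨0, t, h⟩]; simp
  · refine Finset.sum_le_sum fun w _ => ?_
    have hnn : ∀ o : Option (Fin 2 × List FibEdge), (0 : ℝ) ≤ o.elim 0 fun _ => 1 := by
      intro o
      cases o <;> simp
    have h0 := hnn (run (stackStep fibGraph true) (List.ofFn w) (0, []))
    have h1 := hnn (run (stackStep fibGraph true) (List.ofFn w) (1, []))
    split_ifs with h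
    · obtain ⟨v, t, h⟩ := h
      fin_cases v
      · simp only [Fin.zero_eta] at h
        rw [h]
        simpa using h1
      · simp only [Fin.mk_one] at h
        rw [h]
        simpa using h0
    · positivity

theorem isTopologicalEntropy_fib :
    IsTopologicalEntropy fibonacciDyckShift (Real.log (8 / 3)) := by
  refine tendsto_log_div_of_bounds (by norm_num) (fun n hn => ?_) fun μ hμ => ?_
  · have : NeZero n := ⟨hn.ne'⟩
    exact (lower_bound_words n).trans (ncard_admissibleWords_bounds n).1
  · have hμ0 : 0 < μ := by linarith
    obtain ⟨B, hB⟩ := upper_bound_words (r := μ⁻¹) (by positivity)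
      ((inv_lt_comm₀ hμ0 (by norm_num)).2 (by norm_num; exact hμ))
    refine ⟨B 0 + B 1, fun n hn => ?_⟩
    have : NeZero n := ⟨hn.ne'⟩
    refine (ncard_admissibleWords_bounds n).2.trans ?_
    have h0 := hB n 0
    have h1 := hB n 1
    rw [inv_pow, inv_mul_le_iff₀ (pow_pos hμ0 n)] at h0 h1
    linarith

end Entropy

/-! ### The root of the cubic equation -/

section Cubic

theorem continuousOn_xi : ContinuousOn xi (Metric.closedBall 0 (2 / (3 * √3))) := by
  refine continuousOn_id.mul ?_
  refine continuousOn_tsum (u := fun w : dyckWords fibGraph 1 =>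
    (2 / (3 * √3)) ^ (w : List (Letter FibEdge)).length) (fun w => by fun_prop)
    (summable_radius 1).1 fun w z hz => ?_
  rw [norm_pow]
  exact pow_le_pow_left₀ (norm_nonneg z) (mem_closedBall_zero_iff.1 hz) _

theorem analyticOnNhd_xi : AnalyticOnNhd ℂ xi (Metric.ball 0 (2 / (3 * √3))) := by
  refine DifferentiableOn.analyticOnNhd ?_ Metric.isOpen_ball
  refine differentiableOn_id.mul ?_
  refine Complex.differentiableOn_tsum_of_summable_norm (u := fun w : dyckWords fibGraph 1 =>
    (2 / (3 * √3)) ^ (w : List (Letter FibEdge)).length) (summable_radius 1).1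
    (fun w => by fun_prop) Metric.isOpen_ball fun w z hz => ?_
  rw [norm_pow]
  exact pow_le_pow_left₀ (norm_nonneg z) (mem_ball_zero_iff.1 hz).le _

/-- The set of agreement is clopen in the connected disc. Subtracting the cubics shows that two
different roots satisfy `η² + ηξ + ξ² = 1`, a closed condition. If it held where they agree, then
`3ξ² = 1` and `z² = 4/27`, outside the open disc. -/
theorem eqOn_xi {ρ : ℝ} (hρ : 0 < ρ) (hρR : ρ ≤ 2 / (3 * √3)) {η : ℂ → ℂ}
    (hη : ContinuousOn η (Metric.ball 0 ρ)) (h0 : η 0 = 0)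
    (hcub : ∀ z ∈ Metric.ball (0 : ℂ) ρ, η z ^ 3 - η z + z = 0) :
    EqOn η xi (Metric.ball 0 ρ) := by
  have hlt : ∀ z ∈ Metric.ball (0 : ℂ) ρ, ‖z‖ < 2 / (3 * √3) := fun z hz =>
    (mem_ball_zero_iff.1 hz).trans_le hρR
  have hξ : ContinuousOn xi (Metric.ball 0 ρ) := continuousOn_xi.mono fun z hz =>
    mem_closedBall_zero_iff.2 (hlt z hz).le
  have hη' := continuousOn_iff_continuous_domRestrict.1 hη
  have hξ' := continuousOn_iff_continuous_domRestrict.1 hξ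
  have : PreconnectedSpace (Metric.ball (0 : ℂ) ρ) :=
    Subtype.preconnectedSpace (convex_ball 0 ρ).isPreconnected
  set U : Set (Metric.ball (0 : ℂ) ρ) := {z | η z = xi z} with hU
  have hclosed : IsClosed U := isClosed_eq hη' hξ'
  have hopen : IsOpen U := by
    have hcompl : Uᶜ = {z : Metric.ball (0 : ℂ) ρ | η z ^ 2 + η z * xi z + xi z ^ 2 = 1} := by
      ext ⟨z, hz⟩
      simp only [hU, Set.mem_compl_iff, Set.mem_ofPred_eq]
      have e1 := hcub z hz
      have e2 := xi_cubic (hlt z hz).le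
      have e3 : (η z - xi z) * (η z ^ 2 + η z * xi z + xi z ^ 2 - 1) = 0 := by
        linear_combination e1 - e2
      constructor
      · intro hne
        exact sub_eq_zero.1 ((mul_eq_zero.1 e3).resolve_left (sub_ne_zero.2 hne))
      · intro h1 heq
        rw [heq] at h1
        have h3 : xi z ^ 2 = 1 / 3 := by linear_combination h1 / 3
        have hz2 : z ^ 2 = 4 / 27 := by
          have : z = xi z * (1 - xi z ^ 2) := by linear_combination e2
          rw [this, mul_pow, h3]
          norm_num
        have hn : ‖z‖ ^ 2 = 4 / 27 := by
          rw [← norm_pow, hz2]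
          norm_num
        have := pow_lt_pow_left₀ (hlt z hz) (norm_nonneg z) two_ne_zero
        rw [sq_radius, hn] at this
        exact lt_irrefl _ this
    rw [← isClosed_compl_iff, hcompl]
    exact isClosed_eq (((hη'.pow 2).add (hη'.mul hξ')).add (hξ'.pow 2)) continuous_const
  have huniv : U = Set.univ := IsClopen.eq_univ ⟨hclosed, hopen⟩
    ⟨⟨0, Metric.mem_ball_self hρ⟩, h0.trans xi_zero.symm⟩
  intro z hz
  exact huniv.symm.subset (Set.mem_univ (⟨z, hz⟩ : Metric.ball (0 : ℂ) ρ))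

/-- Different solutions satisfy `s² + st + t² = 1`, so `st ≥ 1/3` and `(s - t)² ≤ 2/3 - 2/3 = 0`.
This selects the branch of the cubic in the real statements below. -/
theorem eq_of_cubic {s t : ℝ} (hs : s ^ 2 ≤ 1 / 3) (ht : t ^ 2 ≤ 1 / 3)
    (h : s - s ^ 3 = t - t ^ 3) : s = t := by
  by_contra hne
  have h1 : s ^ 2 + s * t + t ^ 2 = 1 := by
    have : (s - t) * (s ^ 2 + s * t + t ^ 2 - 1) = 0 := by linear_combination -h
    exact sub_eq_zero.1 ((mul_eq_zero.1 this).resolve_left (sub_ne_zero.2 hne))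
  have h2 : (s - t) ^ 2 ≤ 0 := by nlinarith
  exact hne (sub_eq_zero.1 (pow_eq_zero_iff two_ne_zero |>.1 (le_antisymm h2 (sq_nonneg _))))

theorem exists_real_xi {x : ℝ} (hx : 0 ≤ x) (hxR : x ≤ 2 / (3 * √3)) :
    ∃ t : ℝ, xi x = t ∧ 0 ≤ t ∧ t ^ 2 ≤ 1 / 3 ∧ t - t ^ 3 = x := by
  refine ⟨x * dyckSeries 1 x, ?_, mul_nonneg hx (dyckSeries_nonneg hx 1), ?_, ?_⟩
  · rw [xi, ← ofReal_dyckSeries, Complex.ofReal_mul]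
  · have h1 := (dyckSeries_le_of_le_radius hx hxR 1).2
    simp only [Matrix.cons_val_one, Matrix.cons_val_fin_one] at h1
    have h2 := dyckSeries_nonneg hx 1
    have h3 := pow_le_pow_left₀ hx hxR 2
    have h4 := pow_le_pow_left₀ h2 h1 2
    rw [sq_radius] at h3
    rw [mul_pow]
    calc _ ≤ (4 / 27 : ℝ) * (3 / 2) ^ 2 := by gcongr
      _ = 1 / 3 := by norm_num
  · have hn : ‖(x : ℂ)‖ ≤ 2 / (3 * √3) := by rwa [Complex.norm_real, Real.norm_of_nonneg hx]
    have h := xi_cubic hn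
    rw [xi, ← ofReal_dyckSeries] at h
    have h' : (x * dyckSeries 1 x) ^ 3 - x * dyckSeries 1 x + x = 0 := by exact_mod_cast h
    linear_combination -h'

theorem xi_ofReal {x : ℝ} (hx : 0 ≤ x) (hxR : x ≤ 2 / (3 * √3)) :
    xi x = ((2 / √3 * Real.sin (1 / 3 * Real.arcsin (3 * √3 / 2 * x)) : ℝ) : ℂ) := by
  obtain ⟨t, ht, ht0, ht1, ht2⟩ := exists_real_xi hx hxR
  rw [ht]
  congr 1
  have h3 : (√3) ^ 2 = 3 := Real.sq_sqrt (by norm_num)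
  have h3pos : 0 < √3 := by positivity
  set y := 3 * √3 / 2 * x with hy
  have hy0 : 0 ≤ y := by positivity
  have hy1 : y ≤ 1 := by
    rw [le_div_iff₀ (by positivity)] at hxR
    rw [hy]
    linarith
  set θ := Real.arcsin y with hθ
  have hθ0 : 0 ≤ θ := Real.arcsin_nonneg.2 hy0
  have hθ1 : θ ≤ Real.pi / 2 := Real.arcsin_le_pi_div_two y
  have hsin : Real.sin θ = y := Real.sin_arcsin (by linarith) hy1
  set s := Real.sin (1 / 3 * θ) with hs
  have hs0 : 0 ≤ s := Real.sin_nonneg_of_nonneg_of_le_pi (by positivity)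
    (by linarith [Real.pi_pos])
  -- The angle is at most `π/6`, so `2s/√3` stays within the range `t² ≤ 1/3` where the root is
  -- unique. The triple angle formula then gives the cubic.
  have hs1 : s ≤ 1 / 2 := by
    rw [← Real.sin_pi_div_six]
    exact Real.sin_le_sin_of_le_of_le_pi_div_two (by linarith [Real.pi_pos])
      (by linarith [Real.pi_pos]) (by linarith)
  have htriple : y = 3 * s - 4 * s ^ 3 := by
    rw [← hsin, hs, ← Real.sin_three_mul]
    congr 1
    ring
  refine eq_of_cubic ht1 ?_ (ht2.trans ?_)
  · rw [mul_pow, div_pow, h3]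
    nlinarith
  · have hxy : x = 2 / (3 * √3) * y := by
      rw [hy]
      field_simp
    rw [hxy, htriple]
    have : √3 ^ 3 = 3 * √3 := by rw [pow_succ, h3]
    field_simp
    rw [show √3 ^ 2 = 3 from h3]
    ring

theorem quadratic_xi_ofReal_iff {x : ℝ} (hx : 0 ≤ x) (hxR : x ≤ 2 / (3 * √3)) :
    2 * xi x ^ 2 + xi x - 1 = 0 ↔ x = 3 / 8 := by
  obtain ⟨t, ht, ht0, ht1, ht2⟩ := exists_real_xi hx hxR
  rw [ht]
  have hcast : 2 * (t : ℂ) ^ 2 + t - 1 = 0 ↔ 2 * t ^ 2 + t - 1 = 0 := by exact_mod_cast Iff.rfl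
  rw [hcast]
  constructor
  · intro h
    have hf : (2 * t - 1) * (t + 1) = 0 := by linear_combination h
    have h1 := (mul_eq_zero.1 hf).resolve_right (by positivity)
    have : t = 1 / 2 := by linarith
    rw [← ht2, this]
    norm_num
  · intro h
    have : t = 1 / 2 := eq_of_cubic ht1 (by norm_num) (by rw [ht2, h]; norm_num)
    rw [this]
    norm_num

end Cubic

end MarkovDyck

theorem mainTheorem5 :
    ∃ ξ : ℂ → ℂ,
      -- `ξ` is the root of `ξ³ - ξ + z = 0` vanishing at the origin
      (ContinuousOn ξ (Metric.closedBall 0 (2 / (3 * √3))) ∧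
        AnalyticOnNhd ℂ ξ (Metric.ball 0 (2 / (3 * √3))) ∧
        ξ 0 = 0 ∧
        ∀ z ∈ Metric.closedBall (0 : ℂ) (2 / (3 * √3)), ξ z ^ 3 - ξ z + z = 0) ∧
      -- it is the only continuous one, on every disc about the origin
      (∀ ρ : ℝ, 0 < ρ → ρ ≤ 2 / (3 * √3) → ∀ η : ℂ → ℂ, ContinuousOn η (Metric.ball 0 ρ) →
        η 0 = 0 → (∀ z ∈ Metric.ball (0 : ℂ) ρ, η z ^ 3 - η z + z = 0) →
        EqOn η ξ (Metric.ball 0 ρ)) ∧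
      -- the trigonometric formula
      (∀ x : ℝ, 0 ≤ x → x ≤ 2 / (3 * √3) →
        ξ (x : ℂ) =
          ((2 / √3 * Real.sin (1 / 3 * Real.arcsin (3 * √3 / 2 * x)) : ℝ) : ℂ)) ∧
      -- the zeta function
      (∀ z : ℂ, ‖z‖ < 3 / 8 →
        Summable (fun n : ℕ => MarkovDyck.zetaTerm MarkovDyck.fibonacciDyckShift z (n + 1)) ∧
        2 * ξ z ^ 2 + ξ z - 1 ≠ 0 ∧
        (z ≠ 0 → MarkovDyck.zeta MarkovDyck.fibonacciDyckShift z =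
          ξ z / (z * (2 * ξ z ^ 2 + ξ z - 1) ^ 2))) ∧
      -- the entropy is `-log z₀`, `z₀` the solution of `2ξ² + ξ - 1 = 0`
      (∃ z₀ : ℝ, 0 < z₀ ∧ z₀ < 2 / (3 * √3) ∧
        (∀ x : ℝ, 0 ≤ x → x ≤ 2 / (3 * √3) →
          (2 * ξ (x : ℂ) ^ 2 + ξ (x : ℂ) - 1 = 0 ↔ x = z₀)) ∧
        MarkovDyck.IsTopologicalEntropy MarkovDyck.fibonacciDyckShift (-Real.log z₀)) ∧
      MarkovDyck.IsTopologicalEntropy MarkovDyck.fibonacciDyckShift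
        (3 * Real.log 2 - Real.log 3) := by

  have hlog : Real.log (8 / 3) = 3 * Real.log 2 - Real.log 3 := by
    rw [Real.log_div (by norm_num) (by norm_num), show (8 : ℝ) = 2 ^ 3 by norm_num, Real.log_pow]
    norm_num
  refine ⟨MarkovDyck.xi, ⟨MarkovDyck.continuousOn_xi, MarkovDyck.analyticOnNhd_xi,
    MarkovDyck.xi_zero, fun z hz => MarkovDyck.xi_cubic (mem_closedBall_zero_iff.1 hz)⟩,
    fun ρ hρ hρR η hη h0 hcub => MarkovDyck.eqOn_xi hρ hρR hη h0 hcub,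
    fun x hx hxR => MarkovDyck.xi_ofReal hx hxR, fun z hz => ?_,
    ⟨3 / 8, by norm_num, MarkovDyck.lt_radius,
      fun x hx hxR => MarkovDyck.quadratic_xi_ofReal_iff hx hxR, ?_⟩, ?_⟩
  · obtain ⟨c, -, -, hsum⟩ := MarkovDyck.hasSum_zetaTerm hz
    exact ⟨hsum.summable, MarkovDyck.quadratic_xi_ne_zero hz, MarkovDyck.zeta_fib hz⟩
  · rw [← Real.log_inv, inv_div]
    exact MarkovDyck.isTopologicalEntropy_fib
  · rw [← hlog]
    exact MarkovDyck.isTopologicalEntropy_fib
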